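/- Let $G$ be a discrete group acting isometrically, properly and cocompactly on a non-empty proper metric space $X$ of covering dimension at most $n<\infty$ (proper: $\{g\in G: gK\cap L\neq\emptyset\}$ is finite for all compact $K,L\subseteq X$). Let $\gamma\colon X\times X\times[0,1]\to X$ be a constant-speed bicombing, i.e. a continuous map such that every $\gamma_{x,y}=\gamma(x,y,\cdot)$ is a rectifiable path from $x$ to $y$ of constant speed equal to its length $l(\gamma_{x,y})$. Assume that $\gamma$ is * equivariant: $g\gamma_{x,y}(t)=\gamma_{gx,gy}(t)$; * consistent: $\gamma_{x,y}(t)=\gamma_{\gamma_{x,y}(s),\gamma_{x,y}(s')}\big(\tfrac{t-s}{s'-s}\big)$ whenever $0\le s<s'\le 1$ and $t\in[s,s']$; * $A$-convex: $d(\gamma_{x,y}(t),\gamma_{x',y'}(t))\le A(t,d(x,x'),d(y,y'))$ for some continuous $A\colon[0,1]\times[0,\infty)^2\to[0,\infty)$ with $A(1,s,0)=A(0,0,s)=0$ for all $s\geq 0$; that $\gamma_{x,x}(t)=x$ for all $x,t$, and that there is a continuous $f\colon[0,\infty)\to[0,\infty)$ with $f(0)=0$ and $|l(\gamma_{x,y})-l(\gamma_{x',y'})|\le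 f(d(x,x')+d(y,y'))$ for all $x,x',y,y'\in X$. For $x,y\in X$ let $c_{x,y}\colon\mathbb R\to X$ be the trail with $c_{x,y}(t)=x$ for $t\le 0$, $c_{x,y}(t)=\gamma_{x,y}(t/l(\gamma_{x,y}))$ for $0<t<l(\gamma_{x,y})$ and $c_{x,y}(t)=y$ for $t>0$, $t\ge l(\gamma_{x,y})$. Let $(\Phi_tc)(s)=c(s+t)$. The flow space $FS(X,\gamma)$ is the closure of $\{\Phi_tc_{x,y}: t\in\mathbb R,\ x,y\in X\}$ in the space of continuous maps $\mathbb R\to X$ with the compact-open topology; it consists of $1$-Lipschitz maps and carries the metric $d(c,c')=\int_{\mathbb R}\frac{d(c(t),c'(t))}{2e^{|t|}}\,dt$, the flow $\Phi$ and the $G$-action $(gc)(t)=g\,c(t)$. Definitions. A *flow space* for $G$ is a metric space with a continuous action of $G\times\mathbb R$ such that $G$ acts isometrically and properly. A *strong homotopy action* of $G$ on a space $Y$ is a continuous map $\Psi\colon\coprod_{j\ge0}(G\times[0,1])^j\times G\times Y\to Y$ such that $\Psi(\dots,g_l,0,g_{l-1},\dots)=\Psi(\dots,g_l,\Psi(g_{l-1},\dots))$;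 $\Psi(\dots,g_l,1,g_{l-1},\dots)=\Psi(\dots,g_lg_{l-1},\dots)$; $\Psi(e,t_j,g_{j-1},\dots)=\Psi(g_{j-1},\dots)$; $\Psi(\dots,t_l,e,t_{l-1},\dots)=\Psi(\dots,t_lt_{l-1},\dots)$; $\Psi(\dots,t_1,e,y)=\Psi(\dots,y)$; and $\Psi(e,y)=y$. For $S\subseteq G$, $k\in\mathbb N$ and $g\in G$ let $F_g(\Psi,S,k)$ be the set of all maps $\Psi(g_k,t_k,\dots,g_0,\cdot)\colon Y\to Y$ with $g_i\in S$, $t_i\in[0,1]$ and $g_k\cdots g_0=g$. A metric space $Y$ is *controlled $N$-dominated* if for every $\varepsilon>0$ there are a finite CW-complex $K$ of dimension at most $N$, continuous maps $i\colon Y\to K$, $p\colon K\to Y$ and a homotopy $H$ from $p\circ i$ to $\mathrm{id}_Y$ such that $\{H(y,t):t\in[0,1]\}$ has diameter at most $\varepsilon$ for every $y\in Y$. A flow space $FS$ for $G$ *admits strong contracting transfers* if there is $N\in\mathbb N$ such that for every finite $S\subseteq G$ and every $k\in\mathbb N$ there is $\beta>0$ such that for every $\delta>0$ there are $T>0$,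 a contractible, compact, controlled $N$-dominated metric space $Y$, a strong homotopy action $\Psi$ of $G$ on $Y$, and a continuous map $\iota\colon G\times Y\to FS$ with $\iota(gg',y)=g\,\iota(g',y)$, such that $(\ast)$ for all $(g,y)\in G\times Y$, $s\in S$ and $\varphi\in F_s(\Psi,S,k)$ there is $\tau\in[-\beta,\beta]$ with $d\big(\Phi_T\iota(g,y),\Phi_{T+\tau}\iota(gs^{-1},\varphi(y))\big)\le\delta$. Claim. $FS(X,\gamma)$ is a flow space for $G$ and admits strong contracting transfers. More precisely, let $x_0\in X$. For $R>0$ put $P_R(x_0)=\{y\in X: l(\gamma_{x_0,y})\le R\}$, $H_t(x)=c_{x_0,x}\big((1-t)(R-l(\gamma_{x_0,x}))+l(\gamma_{x_0,x})\big)$, $\Omega(g,x)=gx$ and $\Omega(g_j,t_j,g_{j-1},\dots,g_0,x)=g_jH_{t_j}(\Omega(g_{j-1},\dots,g_0,x))$. Then: 1. For every $R>0$, the space $P_R(x_0)$ is compact, contractible and controlled $(2n+1)$-dominated, and $\Psi=H_0\circ\Omega$ defines a strong homotopy action of $G$ on $P_R(x_0)$. 2. For every finite $S\subseteq G$ and every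 $k\in\mathbb N$ there is $\beta>0$ such that for every $\delta>0$ there are $T,R>0$ such that the map $\iota\colon G\times P_R(x_0)\to FS(X,\gamma)$, $\iota(g,x)=c_{gx_0,gx}$, is continuous and $G$-equivariant and satisfies $(\ast)$ for $Y=P_R(x_0)$ and $\Psi=H_0\circ\Omega$. -/

import Mathlib

open Set Topology MeasureTheory
open scoped NNReal ENNReal unitInterval

universe u

/-! ## Covering dimension -/

/-- The topological space `X` has covering dimension at most `n`: every open cover of `X` has an
open refinement covering `X` such that every point lies in at most `n + 1` of its members. -/
def CoveringDimLE (X : Type*) [TopologicalSpace X] (n : ℕ) : Prop :=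
  ∀ U : Set (Set X), (∀ s ∈ U, IsOpen s) → ⋃₀ U = univ →
    ∃ V : Set (Set X), (∀ s ∈ V, IsOpen s) ∧ ⋃₀ V = univ ∧ (∀ s ∈ V, ∃ t ∈ U, s ⊆ t) ∧
      ∀ x : X, {s ∈ V | x ∈ s}.encard ≤ n + 1

/-! ## Bicombings -/

/-- The length of a path parametrised by the unit interval (meaningful if it is rectifiable). -/
noncomputable def curveLength {X : Type*} [MetricSpace X] (p : I → X) : ℝ :=
  (eVariationOn p univ).toReal

/-- A constant-speed bicombing on a metric space `X`: a continuous map `X × X × [0,1] → X` such that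
for all `x`, `y` the path `t ↦ γ (x, y, t)` is rectifiable, leads from `x` to `y`, and has constant
speed equal to its length. -/
structure Bicombing (X : Type u) [MetricSpace X] where
  toMap : C(X × X × I, X)
  source : ∀ x y, toMap (x, y, 0) = x
  target : ∀ x y, toMap (x, y, 1) = y
  rectifiable : ∀ x y, eVariationOn (fun t : I => toMap (x, y, t)) univ ≠ ∞
  constant_speed : ∀ x y, ∀ s t : I, s ≤ t →
    eVariationOn (fun r : I => toMap (x, y, r)) (Icc s t) =
      ENNReal.ofReal (((t : ℝ) - s) * curveLength (fun r : I => toMap (x, y, r)))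

namespace Bicombing

variable {X : Type u} [MetricSpace X] (γ : Bicombing X)

/-- The path `γ_{x,y} : [0,1] → X`. -/
def path (x y : X) (t : I) : X := γ.toMap (x, y, t)

/-- The length `l(γ_{x,y})`. -/
noncomputable def length (x y : X) : ℝ := curveLength (γ.path x y)

/-- `γ` is consistent:
`γ_{x,y}(t) = γ_{γ_{x,y}(s), γ_{x,y}(s')}((t - s) / (s' - s))` for `s < s'` and `t ∈ [s, s']`
(the quotient lies in `[0,1]`, so that the projection `ℝ → [0,1]` does not change it). -/
def Consistent : Prop :=
  ∀ x y : X, ∀ s s' t : I, s < s' → s ≤ t → t ≤ s' →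
    γ.path x y t = γ.path (γ.path x y s) (γ.path x y s')
      (projIcc 0 1 zero_le_one (((t : ℝ) - s) / ((s' : ℝ) - s)))

/-- `γ` is `A`-convex for the continuous function `A : [0,1] × [0,∞) × [0,∞) → [0,∞)`. -/
structure AConvex (A : I × ℝ≥0 × ℝ≥0 → ℝ≥0) : Prop where
  continuous : Continuous A
  one_zero : ∀ s, A (1, s, 0) = 0
  zero_zero : ∀ s, A (0, 0, s) = 0
  dist_le : ∀ (x x' y y' : X) (t : I),
    dist (γ.path x y t) (γ.path x' y' t) ≤ A (t, nndist x x', nndist y y')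

/-- The lengths of the paths of `γ` vary in a way that is controlled by the continuous function
`f : [0,∞) → [0,∞)` with `f 0 = 0`. -/
structure LengthControl (f : ℝ≥0 → ℝ≥0) : Prop where
  continuous : Continuous f
  zero : f 0 = 0
  abs_sub_le : ∀ x x' y y' : X,
    |γ.length x y - γ.length x' y'| ≤ f (nndist x x' + nndist y y')

/-- `γ` is equivariant for the action of `G` on `X`. -/
class Equivariant (G : Type*) [Group G] [MulAction G X] (γ : Bicombing X) : Prop where
  smul_path : ∀ (g : G) (x y : X) (t : I), g • γ.path x y t = γ.path (g • x) (g • y) t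

/-! ## The trails of a bicombing -/

/-- The trail `c_{x,y} : ℝ → X`: it rests at `x` until time `0`, then follows `γ_{x,y}` with speed
one until time `l(γ_{x,y})`, and rests at `y` afterwards. -/
noncomputable def trailFun (x y : X) (t : ℝ) : X :=
  if t ≤ 0 then x
  else if γ.length x y ≤ t then y
  else γ.path x y (projIcc 0 1 zero_le_one (t / γ.length x y))

theorem length_nonneg (x y : X) : 0 ≤ γ.length x y := ENNReal.toReal_nonneg

theorem dist_path_le (x y : X) {s t : I} (h : s ≤ t) :
    dist (γ.path x y s) (γ.path x y t) ≤ ((t : ℝ) - s) * γ.length x y := by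
  have h1 := eVariationOn.edist_le (γ.path x y) (s := Icc s t) (x := s) (y := t)
    ⟨le_refl _, h⟩ ⟨h, le_refl _⟩
  have h2 : eVariationOn (γ.path x y) (Icc s t) = ENNReal.ofReal (((t : ℝ) - s) * γ.length x y) :=
    γ.constant_speed x y s t h
  rw [h2, edist_dist] at h1
  have h3 : (0 : ℝ) ≤ ((t : ℝ) - s) * γ.length x y :=
    mul_nonneg (sub_nonneg.2 h) (γ.length_nonneg x y)
  exact (ENNReal.ofReal_le_ofReal_iff h3).1 h1

theorem path_zero (x y : X) : γ.path x y 0 = x := γ.source x y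

theorem path_one (x y : X) : γ.path x y 1 = y := γ.target x y

theorem eq_of_length_eq_zero {x y : X} (h : γ.length x y = 0) : x = y := by
  have h1 := γ.dist_path_le x y (s := 0) (t := 1) zero_le_one
  rw [h, mul_zero, path_zero, path_one] at h1
  exact dist_le_zero.1 h1

theorem trailFun_eq (x y : X) (t : ℝ) :
    γ.trailFun x y t = γ.path x y (projIcc 0 1 zero_le_one (t / γ.length x y)) := by
  have hl := γ.length_nonneg x y
  unfold trailFun
  split_ifs with h1 h2
  · rw [projIcc_of_le_left _ (div_nonpos_of_nonpos_of_nonneg h1 hl)]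
    exact (γ.path_zero x y).symm
  · rcases hl.eq_or_lt with h0 | h0
    · rw [← h0, div_zero, projIcc_left]
      exact (γ.eq_of_length_eq_zero h0.symm).symm.trans (γ.path_zero x y).symm
    · rw [projIcc_of_right_le _ ((one_le_div h0).2 h2)]
      exact (γ.path_one x y).symm
  · rfl

theorem lipschitzWith_trailFun (x y : X) : LipschitzWith 1 (γ.trailFun x y) := by
  have key : ∀ s t : ℝ, s ≤ t → dist (γ.trailFun x y s) (γ.trailFun x y t) ≤ t - s := by
    intro s t hst
    have hl := γ.length_nonneg x y
    rw [trailFun_eq, trailFun_eq]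
    rcases hl.eq_or_lt with h0 | h0
    · rw [← h0, div_zero, div_zero, dist_self]
      linarith
    · have hm : s / γ.length x y ≤ t / γ.length x y := by gcongr
      refine (γ.dist_path_le x y (monotone_projIcc _ hm)).trans ?_
      have hp : |((projIcc 0 1 zero_le_one (t / γ.length x y) : I) : ℝ)
          - (projIcc 0 1 zero_le_one (s / γ.length x y) : I)|
          ≤ |t / γ.length x y - s / γ.length x y| := abs_projIcc_sub_projIcc _
      rw [abs_of_nonneg (sub_nonneg.2 hm)] at hp
      calc _ ≤ (t / γ.length x y - s / γ.length x y) * γ.length x y := by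
            refine mul_le_mul_of_nonneg_right ?_ hl
            exact (le_abs_self _).trans hp
        _ = t - s := by field_simp
  refine LipschitzWith.of_dist_le_mul fun s t => ?_
  rw [NNReal.coe_one, one_mul, Real.dist_eq]
  rcases le_total s t with h | h
  · rw [abs_sub_comm, abs_of_nonneg (sub_nonneg.2 h)]
    exact key s t h
  · rw [dist_comm, abs_of_nonneg (sub_nonneg.2 h)]
    exact key t s h

/-- The trail `c_{x,y}` as a continuous map. -/
noncomputable def trail (x y : X) : C(ℝ, X) :=
  ⟨γ.trailFun x y, (γ.lipschitzWith_trailFun x y).continuous⟩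

end Bicombing

/-! ## The flow space -/

/-- The flow `Φ` on the space of all continuous maps `ℝ → X`: `(Φ_t c)(s) = c (s + t)`. -/
def flowMap {X : Type u} [TopologicalSpace X] (t : ℝ) (c : C(ℝ, X)) : C(ℝ, X) :=
  c.comp ⟨fun s => s + t, by fun_prop⟩

namespace Bicombing

variable {X : Type u} [MetricSpace X] (γ : Bicombing X)

/-- The closure of `{Φ_t c_{x,y} | t ∈ ℝ, x, y ∈ X}` in the space of continuous maps `ℝ → X` with
the compact-open topology. -/
def flowSet : Set C(ℝ, X) := closure {c | ∃ (t : ℝ) (x y : X), c = flowMap t (γ.trail x y)}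

theorem lipschitzWith_of_mem_flowSet {c : C(ℝ, X)} (hc : c ∈ γ.flowSet) : LipschitzWith 1 c := by
  have hcl : IsClosed {c : C(ℝ, X) | ∀ s t : ℝ, dist (c s) (c t) ≤ dist s t} := by
    simp only [Set.ofPred_forall]
    refine isClosed_iInter fun s => isClosed_iInter fun t => isClosed_le ?_ continuous_const
    exact (continuous_eval_const s).dist (continuous_eval_const t)
  have hsub : γ.flowSet ⊆ {c : C(ℝ, X) | ∀ s t : ℝ, dist (c s) (c t) ≤ dist s t} := by
    refine closure_minimal ?_ hcl
    rintro _ ⟨τ, x, y, rfl⟩ s t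
    have h := (γ.lipschitzWith_trailFun x y).dist_le_mul (s + τ) (t + τ)
    simpa [flowMap, trail] using h
  exact LipschitzWith.of_dist_le_mul fun s t => by simpa using hsub hc s t

/-- The flow space `FS(X, γ)`. -/
def FlowSpace : Type u := {c : C(ℝ, X) // c ∈ γ.flowSet}

namespace FlowSpace

variable {γ}

theorem integrable_dist (c d : γ.FlowSpace) :
    Integrable fun t : ℝ => dist (c.1 t) (d.1 t) / (2 * Real.exp |t|) := by
  set C : ℝ := dist (c.1 0) (d.1 0) with hC
  have hC0 : 0 ≤ C := dist_nonneg
  have hcont : Continuous fun t : ℝ => dist (c.1 t) (d.1 t) / (2 * Real.exp |t|) := by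
    refine Continuous.div (c.1.continuous.dist d.1.continuous) (by fun_prop) fun t => ?_
    positivity
  refine Integrable.mono' (integrable_inv_one_add_sq.const_mul (3 * C + 14))
    hcont.aestronglyMeasurable (Filter.Eventually.of_forall fun t => ?_)
  have h1 : dist (c.1 t) (d.1 t) ≤ C + 2 * |t| := by
    have hc := (γ.lipschitzWith_of_mem_flowSet c.2).dist_le_mul t 0
    have hd := (γ.lipschitzWith_of_mem_flowSet d.2).dist_le_mul 0 t
    simp only [NNReal.coe_one, one_mul, Real.dist_eq, sub_zero, zero_sub, abs_neg] at hc hd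
    have := dist_triangle4 (c.1 t) (c.1 0) (d.1 0) (d.1 t)
    linarith
  rw [Real.norm_of_nonneg (by positivity), ← div_eq_mul_inv,
    div_le_div_iff₀ (by positivity) (by positivity)]
  have e0 := Real.pow_div_factorial_le_exp |t| (abs_nonneg t) 0
  have e1 := Real.pow_div_factorial_le_exp |t| (abs_nonneg t) 1
  have e2 := Real.pow_div_factorial_le_exp |t| (abs_nonneg t) 2
  have e3 := Real.pow_div_factorial_le_exp |t| (abs_nonneg t) 3
  norm_num [Nat.factorial] at e1 e2 e3 e0
  have ht : |t| * t ^ 2 = |t| ^ 3 := by rw [← sq_abs]; ring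
  have hE : 0 < Real.exp |t| := Real.exp_pos _
  calc dist (c.1 t) (d.1 t) * (1 + t ^ 2) ≤ (C + 2 * |t|) * (1 + t ^ 2) := by gcongr
    _ = C * (1 + t ^ 2) + 2 * (|t| + |t| ^ 3) := by rw [← ht]; ring
    _ ≤ C * (3 * Real.exp |t|) + 2 * (7 * Real.exp |t|) := by
        have : 1 + t ^ 2 ≤ 3 * Real.exp |t| := by linarith [Real.one_le_exp (abs_nonneg t)]
        gcongr
        linarith
    _ ≤ (3 * C + 14) * (2 * Real.exp |t|) := by nlinarith [mul_nonneg hC0 hE.le]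

/-- The metric `d(c, d) = ∫ d_X(c(t), d(t)) / (2 e^{|t|}) dt` on the flow space. -/
noncomputable instance instMetricSpace : MetricSpace γ.FlowSpace where
  dist c d := ∫ t : ℝ, dist (c.1 t) (d.1 t) / (2 * Real.exp |t|)
  dist_self c := by simp
  dist_comm c d := by simp only [dist_comm]
  dist_triangle c d e := by
    rw [← integral_add (integrable_dist c d) (integrable_dist d e)]
    refine integral_mono (integrable_dist c e)
      ((integrable_dist c d).add (integrable_dist d e)) fun t => ?_
    simp only [← add_div]
    gcongr
    exact dist_triangle _ _ _
  eq_of_dist_eq_zero := by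
    intro c d h
    have hcont : Continuous fun t : ℝ => dist (c.1 t) (d.1 t) / (2 * Real.exp |t|) := by
      refine Continuous.div (c.1.continuous.dist d.1.continuous) (by fun_prop) fun t => ?_
      positivity
    have h1 := (integral_eq_zero_iff_of_nonneg (fun t => by positivity)
      (integrable_dist c d)).1 h
    have h2 := (hcont.ae_eq_iff_eq volume continuous_zero).1 h1
    refine Subtype.ext (ContinuousMap.ext fun t => ?_)
    have h3 := congrFun h2 t
    simp only [Pi.zero_apply, div_eq_zero_iff] at h3
    rcases h3 with h3 | h3
    · exact dist_eq_zero.1 h3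
    · exact absurd h3 (by positivity)

theorem flowMap_mem {c : C(ℝ, X)} (hc : c ∈ γ.flowSet) (t : ℝ) : flowMap t c ∈ γ.flowSet := by
  refine map_mem_closure (f := flowMap t) (ContinuousMap.continuous_precomp _) hc ?_
  rintro _ ⟨s, x, y, rfl⟩
  refine ⟨t + s, x, y, ContinuousMap.ext fun r => ?_⟩
  simp [flowMap, add_assoc]

/-- The flow on `FS(X, γ)`, written additively: `t +ᵥ c` is `Φ_t c`. -/
instance instAddAction : AddAction ℝ γ.FlowSpace where
  vadd t c := ⟨flowMap t c.1, flowMap_mem c.2 t⟩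
  zero_vadd c := Subtype.ext (ContinuousMap.ext fun s => congrArg c.1 (add_zero s))
  add_vadd a b c := Subtype.ext (ContinuousMap.ext fun s => congrArg c.1 (add_assoc s a b).symm)

section Action

variable {G : Type*} [Group G] [MulAction G X] [IsIsometricSMul G X] [γ.Equivariant G]

/-- Post-composition with the action of a group element. -/
def smulMap (g : G) (c : C(ℝ, X)) : C(ℝ, X) :=
  ⟨fun t => g • c t, (isometry_smul X g).continuous.comp c.continuous⟩

theorem length_smul (g : G) (x y : X) : γ.length (g • x) (g • y) = γ.length x y := by
  have h : γ.path (g • x) (g • y) = fun t => g • γ.path x y t :=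
    funext fun t => (Equivariant.smul_path g x y t).symm
  simp only [length, curveLength, h, eVariationOn, edist_smul_left]

theorem smulMap_trail (g : G) (x y : X) :
    smulMap g (γ.trail x y) = γ.trail (g • x) (g • y) := by
  refine ContinuousMap.ext fun t => ?_
  change g • γ.trailFun x y t = γ.trailFun (g • x) (g • y) t
  rw [trailFun_eq, trailFun_eq, length_smul, Equivariant.smul_path]

theorem smulMap_mem (g : G) {c : C(ℝ, X)} (hc : c ∈ γ.flowSet) : smulMap g c ∈ γ.flowSet := by
  refine map_mem_closure (f := smulMap g)
    (ContinuousMap.continuous_postcomp ⟨_, (isometry_smul X g).continuous⟩) hc ?_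
  rintro _ ⟨s, x, y, rfl⟩
  exact ⟨s, g • x, g • y, by rw [← smulMap_trail]; rfl⟩

/-- The action of `G` on `FS(X, γ)`: `(g • c)(t) = g • c(t)`. -/
instance instMulAction : MulAction G γ.FlowSpace where
  smul g c := ⟨smulMap g c.1, smulMap_mem g c.2⟩
  one_smul c := Subtype.ext (ContinuousMap.ext fun t => one_smul G (c.1 t))
  mul_smul g h c := Subtype.ext (ContinuousMap.ext fun t => mul_smul g h (c.1 t))

end Action

/-- The trail `c_{x,y}` as a point of the flow space. -/
noncomputable def ofTrail (γ : Bicombing X) (x y : X) : γ.FlowSpace :=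
  ⟨γ.trail x y, subset_closure ⟨0, x, y, ContinuousMap.ext fun s =>
    congrArg (γ.trail x y) (add_zero s).symm⟩⟩

end FlowSpace

/-! ## The balls `P_R(x₀)` and the retraction onto them -/

/-- The ball `P_R(x₀) = {y | l(c_{x₀,y}) ≤ R}`. The trail `c_{x₀,y}` has the length of
`γ_{x₀,y}`. -/
def ball (x₀ : X) (R : ℝ) : Set X := {y | γ.length x₀ y ≤ R}

/-- The deformation `H_t(x) = c_{x₀,x}((1 - t)(R - l(c_{x₀,x})) + l(c_{x₀,x}))` of `X`; `H_1` is the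
identity and `H_0` retracts `X` onto `P_R(x₀)`. -/
noncomputable def deformation (x₀ : X) (R : ℝ) (t : I) (x : X) : X :=
  γ.trail x₀ x ((1 - (t : ℝ)) * (R - γ.length x₀ x) + γ.length x₀ x)

/-- The maps `Ω(g₀, x) = g₀ x` and
`Ω(g_j, t_j, g_{j-1}, …, g₀, x) = g_j H_{t_j}(Ω(g_{j-1}, t_{j-1}, …, g₀, x))`. -/
noncomputable def omega {G : Type*} [Group G] [MulAction G X] (x₀ : X) (R : ℝ) :
    List (G × I) → G → X → X
  | [], g₀, x => g₀ • x
  | (g, t) :: l, g₀, x => g • γ.deformation x₀ R t (omega x₀ R l g₀ x)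

end Bicombing

/-! ## Strong homotopy actions and strong contracting transfers -/

/-- A strong homotopy action of the discrete group `G` on `Y`, that is, a continuous map
`Ψ : ∐_{j ≥ 0} (G × [0,1])^j × G × Y → Y` with the usual six properties. The value
`Ψ(g_j, t_j, g_{j-1}, t_{j-1}, …, g_1, t_1, g_0, y)` is written
`Ψ [(g_j, t_j), …, (g_1, t_1)] g_0 y`. -/
structure StrongHomotopyAction (G : Type*) [Group G] [TopologicalSpace G]
    (Y : Type*) [TopologicalSpace Y] where
  toFun : List (G × I) → G → Y → Y
  continuous_toFun : ∀ j : ℕ, Continuous fun p : (Fin j → G × I) × G × Y =>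
    toFun (List.ofFn p.1) p.2.1 p.2.2
  /-- `Ψ(…, g_l, 0, g_{l-1}, …) = Ψ(…, g_l, Ψ(g_{l-1}, …))` -/
  time_zero : ∀ (a b : List (G × I)) (g g₀ : G) (y : Y),
    toFun (a ++ (g, 0) :: b) g₀ y = toFun a g (toFun b g₀ y)
  /-- `Ψ(…, g_l, 1, g_{l-1}, …) = Ψ(…, g_l * g_{l-1}, …)` where `l ≥ 2` -/
  time_one : ∀ (a b : List (G × I)) (g h : G) (t : I) (g₀ : G) (y : Y),
    toFun (a ++ (g, 1) :: (h, t) :: b) g₀ y = toFun (a ++ (g * h, t) :: b) g₀ y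
  /-- `Ψ(…, g_1, 1, g_0, y) = Ψ(…, g_1 * g_0, y)` -/
  time_one_last : ∀ (a : List (G × I)) (g g₀ : G) (y : Y),
    toFun (a ++ [(g, 1)]) g₀ y = toFun a (g * g₀) y
  /-- `Ψ(e, t_j, g_{j-1}, …) = Ψ(g_{j-1}, …)` -/
  one_first : ∀ (t : I) (b : List (G × I)) (g₀ : G) (y : Y),
    toFun ((1, t) :: b) g₀ y = toFun b g₀ y
  /-- `Ψ(…, t_l, e, t_{l-1}, …) = Ψ(…, t_l * t_{l-1}, …)` -/
  one_middle : ∀ (a b : List (G × I)) (g : G) (s t : I) (g₀ : G) (y : Y),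
    toFun (a ++ (g, s) :: (1, t) :: b) g₀ y = toFun (a ++ (g, s * t) :: b) g₀ y
  /-- `Ψ(…, t_1, e, y) = Ψ(…, y)` -/
  one_last : ∀ (a : List (G × I)) (g : G) (t : I) (y : Y),
    toFun (a ++ [(g, t)]) 1 y = toFun a g y
  /-- `Ψ(e, y) = y` -/
  one_nil : ∀ y : Y, toFun [] 1 y = y

/-- The set `F_g(Ψ, S, k)` of all maps `Ψ(g_k, t_k, …, g_0, ?) : Y → Y` with `g_i ∈ S`,
`t_i ∈ [0,1]` and `g_k ⋯ g_0 = g`. -/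
def StrongHomotopyAction.maps {G : Type*} [Group G] [TopologicalSpace G] {Y : Type*}
    [TopologicalSpace Y] (Ψ : StrongHomotopyAction G Y) (S : Set G) (k : ℕ) (g : G) :
    Set (Y → Y) :=
  {φ | ∃ (a : List (G × I)) (g₀ : G), a.length = k ∧ (∀ p ∈ a, p.1 ∈ S) ∧ g₀ ∈ S ∧
    (a.map Prod.fst).prod * g₀ = g ∧ φ = Ψ.toFun a g₀}

/-- The metric space `Y` is controlled `N`-dominated: for every `ε > 0` there are a finite
CW-complex `K` of dimension at most `N`, maps `i : Y → K` and `p : K → Y`, and a homotopy from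
`p ∘ i` to the identity whose tracks have diameter at most `ε`. -/
def ControlledDominated (N : ℕ) (Y : Type*) [MetricSpace Y] : Prop :=
  ∀ ε : ℝ, 0 < ε → ∃ (K : Type) (_ : TopologicalSpace K) (_ : T2Space K)
    (_ : CWComplex (univ : Set K)),
    CWComplex.Finite (univ : Set K) ∧
    (∀ m : ℕ, N < m → IsEmpty (RelCWComplex.cell (univ : Set K) m)) ∧
    ∃ (i : C(Y, K)) (p : C(K, Y)) (H : (p.comp i).Homotopy (ContinuousMap.id Y)),
      ∀ y : Y, Metric.diam (range fun t : I => H (t, y)) ≤ ε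

/-- `FS` is a flow space for the discrete group `G`: a metric space with commuting actions of `G`
and `ℝ` that form a continuous action of `G × ℝ`, where `G` acts isometrically and properly. The
action of `ℝ`, that is, the flow `Φ`, is written `t +ᵥ c`. -/
structure IsFlowSpace (G : Type*) [Group G] [TopologicalSpace G] (FS : Type*) [MetricSpace FS]
    [MulAction G FS] [AddAction ℝ FS] : Prop where
  smul_vadd : ∀ (g : G) (t : ℝ) (c : FS), g • (t +ᵥ c) = t +ᵥ (g • c)
  continuous_action : Continuous fun p : (G × ℝ) × FS => p.1.1 • (p.1.2 +ᵥ p.2)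
  isometric : IsIsometricSMul G FS
  proper : ProperlyDiscontinuousSMul G FS

/-- The map `ι : G × Y → FS` is `G`-equivariant, where `g • (g', y) = (g g', y)`, and for all
`(g, y)`, `s ∈ S` and `φ ∈ F_s(Ψ, S, k)` there is `τ ∈ [-β, β]` such that
`d(Φ_T ι(g, y), Φ_{T + τ} ι(g s⁻¹, φ y)) ≤ δ`. -/
def IsContractingTransfer {G : Type*} [Group G] [TopologicalSpace G] {FS : Type*} [MetricSpace FS]
    [MulAction G FS] [AddAction ℝ FS] {Y : Type*} [TopologicalSpace Y]
    (S : Set G) (k : ℕ) (β δ T : ℝ) (Ψ : StrongHomotopyAction G Y) (ι : C(G × Y, FS)) : Prop :=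
  (∀ (g g' : G) (y : Y), ι (g * g', y) = g • ι (g', y)) ∧
  ∀ (g : G) (y : Y), ∀ s ∈ S, ∀ φ ∈ Ψ.maps S k s, ∃ τ ∈ Icc (-β) β,
    dist (T +ᵥ ι (g, y)) ((T + τ) +ᵥ ι (g * s⁻¹, φ y)) ≤ δ

/-- The flow space `FS` for `G` admits strong contracting transfers. -/
def AdmitsStrongContractingTransfers (G : Type*) [Group G] [TopologicalSpace G] (FS : Type u)
    [MetricSpace FS] [MulAction G FS] [AddAction ℝ FS] : Prop :=
  ∃ N : ℕ, ∀ (S : Set G), S.Finite → ∀ k : ℕ, ∃ β : ℝ, 0 < β ∧ ∀ δ : ℝ, 0 < δ →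
    ∃ (T : ℝ) (Y : Type u) (_ : MetricSpace Y) (Ψ : StrongHomotopyAction G Y) (ι : C(G × Y, FS)),
      0 < T ∧ ContractibleSpace Y ∧ CompactSpace Y ∧ ControlledDominated N Y ∧
      IsContractingTransfer S k β δ T Ψ ι

/-!
The statement has three parts, and each of them rests on consistency: the trail from `x₀` to a
point of `c_{x₀,y}` is an initial segment of `c_{x₀,y}` (`Bicombing.Consistent.trail_trail`), and
the point at time `u` has length `u` from `x₀`. Hence the deformations satisfy
`H_s ∘ H_t = H_{s t}`, `H_1 = id`, and `H_0` is a retraction onto `P_R(x₀)`. The rules of a strong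
homotopy action for `H_0 ∘ Ω` are formal consequences, and `P_R(x₀)` is contracted along the paths
of the bicombing.

**Flow space.** Since all curves are 1-Lipschitz, distances in the flow space are controlled by
distances of points at bounded times (`Bicombing.FlowSpace.dist_le_of_forall_abs_le`), and
evaluation at time `0` maps bounded sets to bounded sets, which gives properness.

**Controlled domination.** By length control, the path between two close points stays close to
them. Given a fine open cover of `X` such that every point lies in at most `n + 1` of its members,
a bump covering of `P_R(x₀)` subordinate to a finite part of it maps `P_R(x₀)` to a cube. Every
point has a coordinate `1` and at most `n + 1` nonzero coordinates, so that the image lies in the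
`n`-skeleton of the cube, a finite CW complex with the faces as cells. For the map back, one walks
through the members of the cover in a fixed order, and goes from the current position along the
path of the bicombing towards a chosen point of the member, for the time given by the coordinate
(`Bicombing.walk`). No normalisation is needed, so this is continuous on the cube. The start of the
walk is forgotten at a coordinate `1`, and the at most `n + 1` nontrivial steps are short on the
image of `P_R(x₀)` (`Bicombing.LengthControl.exists_dist_walk_lt_of_eq_one`); composing with `H_0`
leads back to `P_R(x₀)`, and paths of the bicombing give the homotopy.

**Contraction.** If `φ = H_0 ∘ Ω(g_k, t_k, …, g_0, ·)` and `g = g_k ⋯ g_0`, then `g⁻¹ φ(y)` arises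
from `y` by deformations towards the points `(g_i ⋯ g_0)⁻¹ x₀`. A deformation does not change the
trail from its centre before time `R`. Therefore only the change from one centre to the next has to
be estimated. By convexity, trails from two centres to a common end point are close after a bounded
shift of time, at times that are large but at bounded distance from the end
(`Bicombing.AConvex.dist_trail_add_le`). So one chooses `T` large and `R - T` bounded in terms of
`δ`, and sums over the `k + 1` changes of the centre (`Bicombing.exists_shift_dist_omega_le`).
-/

/-! ### Skeleta of cubes as finite CW complexes -/

/-- The `n`-skeleton of the cube `[-1,1]^m`: the points of the cube with at most `n` coordinates
in the open interval `(-1,1)`. -/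
def CubeSkeleton (m n : ℕ) : Type :=
  {x : Fin m → ℝ // (∀ i, |x i| ≤ 1) ∧ {i | |x i| < 1}.ncard ≤ n}

namespace CubeSkeleton

variable {m n : ℕ}

instance : TopologicalSpace (CubeSkeleton m n) := instTopologicalSpaceSubtype

instance : T2Space (CubeSkeleton m n) := inferInstanceAs (T2Space (Subtype _))

/-- The faces of dimension `d` of the `n`-skeleton of `[-1,1]^m`. A face is given by a vector `ε` of
signs: the coordinates where `ε` vanishes are free, the others are fixed at `ε i = ±1`. -/
def Face (m n d : ℕ) : Type :=
  {ε : Fin m → SignType // {i | ε i = 0}.ncard = d ∧ d ≤ n}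

instance (d : ℕ) : Finite (Face m n d) := inferInstanceAs (Finite (Subtype _))

/-- An enumeration of the free coordinates of a face. -/
noncomputable def Face.equiv {d : ℕ} (ε : Face m n d) : Fin d ≃ {i | ε.1 i = 0} :=
  (Fin.castOrderIso ε.2.1.symm).toEquiv.trans (Finite.equivFin _).symm

/-- The retraction of the real line onto `[-1,1]`. -/
noncomputable def clamp (t : ℝ) : ℝ := max (-1) (min 1 t)

theorem continuous_clamp : Continuous clamp := by unfold clamp; fun_prop

theorem abs_clamp_le (t : ℝ) : |clamp t| ≤ 1 :=
  abs_le.2 ⟨le_max_left _ _, max_le (by norm_num) (min_le_left _ _)⟩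

theorem clamp_of_abs_le {t : ℝ} (h : |t| ≤ 1) : clamp t = t := by
  rw [clamp, min_eq_right (abs_le.1 h).2, max_eq_right (abs_le.1 h).1]

theorem abs_coe_sign {s : SignType} (h : s ≠ 0) : |(s : ℝ)| = 1 := by
  cases s <;> simp_all

/-- The characteristic map of a face, extended to all of `ℝ^d` by clamping the coordinates. -/
noncomputable def Face.toFun {d : ℕ} (ε : Face m n d) (y : Fin d → ℝ) : CubeSkeleton m n :=
  ⟨fun i => if h : ε.1 i = 0 then clamp (y (ε.equiv.symm ⟨i, h⟩)) else ε.1 i, fun i => by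
    dsimp only
    split_ifs with h
    · exact abs_clamp_le _
    · exact (abs_coe_sign h).le, by
    refine (ncard_le_ncard (fun i hi => ?_) (toFinite _)).trans (ε.2.1.trans_le ε.2.2)
    by_contra h
    have h' : ¬ ε.1 i = 0 := h
    simp only [mem_ofPred_eq, dif_neg h', abs_coe_sign h'] at hi
    exact lt_irrefl _ hi⟩

theorem Face.toFun_free {d : ℕ} (ε : Face m n d) (y : Fin d → ℝ) (j : Fin d) :
    (ε.toFun y).1 (ε.equiv j) = clamp (y j) := by
  have h : ε.1 (ε.equiv j) = 0 := (ε.equiv j).2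
  simp [Face.toFun, h]

theorem Face.toFun_fixed {d : ℕ} (ε : Face m n d) (y : Fin d → ℝ) {i : Fin m} (h : ε.1 i ≠ 0) :
    (ε.toFun y).1 i = ε.1 i := by
  simp [Face.toFun, h]

theorem Face.continuous_toFun {d : ℕ} (ε : Face m n d) : Continuous ε.toFun := by
  refine Continuous.subtype_mk (continuous_pi fun i => ?_) _
  by_cases h : ε.1 i = 0
  · simp only [h, dite_true]
    exact continuous_clamp.comp (continuous_apply _)
  · simp only [h, dite_false]
    exact continuous_const

theorem mem_closedBall_pi {d : ℕ} {y : Fin d → ℝ} :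
    y ∈ Metric.closedBall (0 : Fin d → ℝ) 1 ↔ ∀ j, |y j| ≤ 1 := by
  rw [mem_closedBall_zero_iff, pi_norm_le_iff_of_nonneg zero_le_one]
  rfl

theorem mem_ball_pi {d : ℕ} {y : Fin d → ℝ} :
    y ∈ Metric.ball (0 : Fin d → ℝ) 1 ↔ ∀ j, |y j| < 1 := by
  rw [mem_ball_zero_iff, pi_norm_lt_iff zero_lt_one]
  rfl

/-- The characteristic map of a face. -/
noncomputable def Face.map {d : ℕ} (ε : Face m n d) :
    PartialEquiv (Fin d → ℝ) (CubeSkeleton m n) where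
  toFun := ε.toFun
  invFun x j := x.1 (ε.equiv j)
  source := Metric.ball 0 1
  target := {x | ∀ i, (ε.1 i = 0 → |x.1 i| < 1) ∧ (ε.1 i ≠ 0 → x.1 i = ε.1 i)}
  map_source' y hy i := by
    refine ⟨fun h => ?_, fun h => ε.toFun_fixed y h⟩
    obtain ⟨j, hj⟩ := ε.equiv.surjective ⟨i, h⟩
    have hi : i = ε.equiv j := by rw [hj]
    rw [hi, ε.toFun_free, clamp_of_abs_le (mem_ball_pi.1 hy j).le]
    exact mem_ball_pi.1 hy j
  map_target' x hx := mem_ball_pi.2 fun j => (hx _).1 (ε.equiv j).2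
  left_inv' y hy := by
    funext j
    rw [ε.toFun_free, clamp_of_abs_le (mem_ball_pi.1 hy j).le]
  right_inv' x hx := by
    refine Subtype.ext (funext fun i => ?_)
    by_cases h : ε.1 i = 0
    · obtain ⟨j, hj⟩ := ε.equiv.surjective ⟨i, h⟩
      have hi : i = ε.equiv j := by rw [hj]
      rw [hi, ε.toFun_free]
      exact clamp_of_abs_le (x.2.1 _)
    · rw [ε.toFun_fixed _ h, (hx i).2 h]

/-- The signs of the smallest face that contains a given point. -/
noncomputable def signs (x : CubeSkeleton m n) (i : Fin m) : SignType :=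
  if |x.1 i| < 1 then 0 else SignType.sign (x.1 i)

theorem signs_eq_zero_iff (x : CubeSkeleton m n) (i : Fin m) : signs x i = 0 ↔ |x.1 i| < 1 := by
  unfold signs
  split_ifs with h
  · simp [h]
  · simp only [sign_eq_zero_iff, h, iff_false]
    rintro h0
    simp [h0] at h

theorem eq_signs (x : CubeSkeleton m n) {i : Fin m} (h : ¬ |x.1 i| < 1) :
    x.1 i = signs x i := by
  have h1 : |x.1 i| = 1 := le_antisymm (x.2.1 i) (not_lt.1 h)
  simp only [signs, h, if_false]
  rcases (abs_eq zero_le_one).1 h1 with h2 | h2 <;> simp [h2]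

theorem Face.eq_of_mem_target {d : ℕ} {ε : Face m n d} {x : CubeSkeleton m n}
    (h : x ∈ ε.map.target) : ε.1 = signs x := by
  funext i
  by_cases h0 : ε.1 i = 0
  · rw [h0, eq_comm, signs_eq_zero_iff]
    exact (h i).1 h0
  · have h1 := (h i).2 h0
    have h2 : ¬ |x.1 i| < 1 := by rw [h1, abs_coe_sign h0]; exact lt_irrefl _
    have h3 := h1.symm.trans (eq_signs x h2)
    revert h3
    cases ε.1 i <;> cases signs x i <;> norm_num

/-- The smallest face that contains a given point. -/
noncomputable def face (x : CubeSkeleton m n) :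
    Face m n {i | |x.1 i| < 1}.ncard :=
  ⟨signs x, by simp only [signs_eq_zero_iff], x.2.2⟩

theorem mem_target_face (x : CubeSkeleton m n) : x ∈ (face x).map.target := fun i =>
  ⟨fun h => (signs_eq_zero_iff x i).1 h, fun h => eq_signs x (mt (signs_eq_zero_iff x i).2 h)⟩

theorem mem_image_face (x : CubeSkeleton m n) :
    x ∈ (face x).map '' Metric.closedBall 0 1 :=
  ⟨(face x).map.symm x, Metric.ball_subset_closedBall ((face x).map.map_target (mem_target_face x)),
    (face x).map.right_inv (mem_target_face x)⟩

theorem eventually_isEmpty_face (m n : ℕ) : ∀ᶠ d in Filter.atTop, IsEmpty (Face m n d) := by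
  filter_upwards [Filter.eventually_gt_atTop n] with d hd
  exact ⟨fun ε => absurd ε.2.2 (not_le.2 hd)⟩

theorem pairwiseDisjoint_face (m n : ℕ) : (univ : Set (Σ d, Face m n d)).PairwiseDisjoint
    (fun ni ↦ ni.2.map '' Metric.ball 0 1) := by
  rintro ⟨d, ε⟩ - ⟨d', ε'⟩ - hne
  refine disjoint_left.2 fun x hx hx' => hne ?_
  have h : x ∈ ε.map.target := by
    obtain ⟨y, hy, rfl⟩ := hx
    exact ε.map.map_source hy
  have h' : x ∈ ε'.map.target := by
    obtain ⟨y, hy, rfl⟩ := hx'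
    exact ε'.map.map_source hy
  have e : ε.1 = ε'.1 := (Face.eq_of_mem_target h).trans (Face.eq_of_mem_target h').symm
  obtain rfl : d = d' := by rw [← ε.2.1, ← ε'.2.1, e]
  rw [Subtype.ext e]

theorem mapsTo_sphere {d : ℕ} (ε : Face m n d) :
    MapsTo ε.map (Metric.sphere 0 1)
      (⋃ (k < d) (τ : Face m n k), τ.map '' Metric.closedBall 0 1) := by
  intro y hy
  simp only [mem_iUnion]
  refine ⟨_, ?_, face (ε.map y), mem_image_face (ε.map y)⟩
  -- Some coordinate of `y` is `±1`; it is free in `ε` and fixed in the smaller face.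
  have hy' : y ∉ Metric.ball (0 : Fin d → ℝ) 1 := fun h => by
    rw [mem_sphere_zero_iff_norm] at hy
    rw [mem_ball_zero_iff, hy] at h
    exact lt_irrefl _ h
  rw [mem_ball_pi] at hy'
  push Not at hy'
  obtain ⟨j, hj⟩ := hy'
  have hj1 : |y j| = 1 :=
    le_antisymm (mem_closedBall_pi.1 (Metric.sphere_subset_closedBall hy) j) hj
  conv_rhs => rw [← ε.2.1]
  refine ncard_lt_ncard ⟨fun i hi => ?_, fun h => ?_⟩ (toFinite _)
  · by_contra h
    have h' : ε.1 i ≠ 0 := h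
    have h2 : (ε.map y).1 i = ε.1 i := ε.toFun_fixed y h'
    rw [mem_ofPred_eq, h2, abs_coe_sign h'] at hi
    exact lt_irrefl _ hi
  · have h1 : |(ε.map y).1 (ε.equiv j)| < 1 := h (ε.equiv j).2
    have h2 : (ε.map y).1 (ε.equiv j) = clamp (y j) := ε.toFun_free y j
    rw [h2, clamp_of_abs_le hj1.le, hj1] at h1
    exact lt_irrefl _ h1

theorem iUnion_face (m n : ℕ) :
    ⋃ (d : ℕ) (ε : Face m n d), ε.map '' Metric.closedBall 0 1 =
      (univ : Set (CubeSkeleton m n)) :=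
  eq_univ_of_forall fun x => mem_iUnion₂.2 ⟨_, face x, mem_image_face x⟩

/-- The CW structure of the `n`-skeleton of a cube: the open cells are the open faces. -/
noncomputable instance : CWComplex (univ : Set (CubeSkeleton m n)) :=
  CWComplex.mkFinite univ (Face m n) (fun _ ε => ε.map) (eventually_isEmpty_face m n)
    (fun _ => inferInstance) (fun _ _ => rfl) (fun _ ε => ε.continuous_toFun.continuousOn)
    (fun _ ε => Continuous.continuousOn
      (continuous_pi fun j => (continuous_apply (ε.equiv j).1).comp continuous_subtype_val))
    (pairwiseDisjoint_face m n) (fun _ ε => mapsTo_sphere ε) (iUnion_face m n)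

theorem finite_univ : CWComplex.Finite (univ : Set (CubeSkeleton m n)) :=
  CWComplex.finite_mkFinite univ (Face m n) (fun _ ε => ε.map) (eventually_isEmpty_face m n)
    (fun _ => inferInstance) (fun _ _ => rfl) (fun _ ε => ε.continuous_toFun.continuousOn)
    (fun _ ε => Continuous.continuousOn
      (continuous_pi fun j => (continuous_apply (ε.equiv j).1).comp continuous_subtype_val))
    (pairwiseDisjoint_face m n) (fun _ ε => mapsTo_sphere ε) (iUnion_face m n)

theorem isEmpty_cell {d : ℕ} (h : n < d) :
    IsEmpty (RelCWComplex.cell (univ : Set (CubeSkeleton m n)) d) :=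
  ⟨fun ε : Face m n d => absurd ε.2.2 (not_le.2 h)⟩

end CubeSkeleton

/-! ### Geometry of a consistent bicombing -/

namespace Bicombing

variable {X : Type u} [MetricSpace X] {γ : Bicombing X}

theorem dist_le_length (x y : X) : dist x y ≤ γ.length x y := by
  have h := γ.dist_path_le x y (s := 0) (t := 1) zero_le_one
  rw [path_zero, path_one] at h
  simpa using h

theorem dist_path_le_length (x y : X) (t : I) : dist x (γ.path x y t) ≤ γ.length x y := by
  have h := γ.dist_path_le x y (s := 0) (t := t) t.2.1
  rw [path_zero] at h
  refine h.trans (mul_le_of_le_one_left (γ.length_nonneg x y) ?_)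
  simpa using t.2.2

theorem length_self (hconst : ∀ (x : X) (t : I), γ.path x x t = x) (x : X) :
    γ.length x x = 0 := by
  have h : γ.path x x = fun _ => x := funext (hconst x)
  rw [length, curveLength, h, eVariationOn.constant_on (subsingleton_of_forall_eq x (by simp))]
  rfl

theorem LengthControl.length_le {f : ℝ≥0 → ℝ≥0} (hf : γ.LengthControl f)
    (hconst : ∀ (x : X) (t : I), γ.path x x t = x) (x y : X) : γ.length x y ≤ f (nndist x y) := by
  have h := hf.abs_sub_le x x y x
  rw [length_self hconst, sub_zero, nndist_self, zero_add, nndist_comm] at h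
  exact (le_abs_self _).trans h

theorem LengthControl.continuous_length {f : ℝ≥0 → ℝ≥0} (hf : γ.LengthControl f) :
    Continuous fun p : X × X => γ.length p.1 p.2 := by
  refine continuous_iff_continuousAt.2 fun p => tendsto_iff_dist_tendsto_zero.2 ?_
  have h : Continuous fun q : X × X => ((f (nndist q.1 p.1 + nndist q.2 p.2) : ℝ≥0) : ℝ) :=
    NNReal.continuous_coe.comp (hf.continuous.comp (by fun_prop))
  have h0 := h.tendsto p
  simp only [nndist_self, add_zero, hf.zero, NNReal.coe_zero] at h0
  exact squeeze_zero (fun _ => dist_nonneg) (fun q => hf.abs_sub_le _ _ _ _) h0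

theorem LengthControl.continuous_length_comp {f : ℝ≥0 → ℝ≥0} (hf : γ.LengthControl f)
    {Z : Type*} [TopologicalSpace Z] {a b : Z → X} (ha : Continuous a) (hb : Continuous b) :
    Continuous fun z => γ.length (a z) (b z) := by
  have h := hf.continuous_length.comp (ha.prodMk hb)
  simpa only [Function.comp_def] using h

/-- Consistency for initial segments: the path to `γ_{x,y}(s)` is an initial segment of
`γ_{x,y}`. -/
theorem Consistent.path_path (hc : γ.Consistent) (hconst : ∀ (x : X) (t : I), γ.path x x t = x)
    (x y : X) (s r : I) : γ.path x (γ.path x y s) r = γ.path x y (s * r) := by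
  rcases s.2.1.eq_or_lt with h0 | h0
  · have hs : s = 0 := Subtype.ext h0.symm
    rw [hs, zero_mul, path_zero, hconst]
  · have h := hc x y 0 s (s * r) h0 (s * r).2.1 (mul_le_of_le_one_right s.2.1 r.2.2)
    rw [h, path_zero]
    congr 1
    have : (((s * r : I) : ℝ) - ((0 : I) : ℝ)) / ((s : ℝ) - ((0 : I) : ℝ)) = r := by
      simp only [Icc.coe_mul, Icc.coe_zero, sub_zero]
      field_simp
    rw [this, projIcc_val]

theorem Consistent.length_path (hc : γ.Consistent) (hconst : ∀ (x : X) (t : I), γ.path x x t = x)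
    (x y : X) (s : I) : γ.length x (γ.path x y s) = s * γ.length x y := by
  have h1 : γ.path x (γ.path x y s) = γ.path x y ∘ fun r => s * r :=
    funext fun r => hc.path_path hconst x y s r
  have hm : Monotone fun r : I => s * r := fun a b h => mul_le_mul_right h s
  have h2 : (fun r : I => s * r) '' univ = Icc 0 s := by
    refine subset_antisymm ?_ fun t ht => ?_
    · rintro _ ⟨r, -, rfl⟩
      exact ⟨(s * r).2.1, mul_le_of_le_one_right s.2.1 r.2.2⟩
    · rw [image_univ]
      rcases s.2.1.eq_or_lt with h0 | h0
      · refine ⟨0, Subtype.ext ?_⟩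
        have h3 : (t : ℝ) ≤ s := ht.2
        have h4 : (0 : ℝ) ≤ t := t.2.1
        simp only [mul_zero, Icc.coe_zero]
        linarith
      · refine ⟨⟨t / s, div_nonneg t.2.1 s.2.1, (div_le_one h0).2 ht.2⟩, Subtype.ext ?_⟩
        simp only [Icc.coe_mul]
        field_simp
  rw [length, curveLength, h1, eVariationOn.comp_eq_of_monotoneOn _ _ (hm.monotoneOn _), h2]
  have h3 : eVariationOn (γ.path x y) (Icc 0 s) =
      ENNReal.ofReal (((s : ℝ) - (0 : I)) * γ.length x y) := γ.constant_speed x y 0 s s.2.1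
  rw [h3, ENNReal.toReal_ofReal]
  · simp
  · simpa using mul_nonneg s.2.1 (γ.length_nonneg x y)

/-! ### Trails -/

theorem trail_apply (x y : X) (t : ℝ) : γ.trail x y t = γ.trailFun x y t := rfl

theorem trail_of_nonpos (x y : X) {t : ℝ} (h : t ≤ 0) : γ.trail x y t = x := by
  rw [trail_apply, trailFun, if_pos h]

theorem trail_of_length_le (x y : X) {t : ℝ} (h : γ.length x y ≤ t) : γ.trail x y t = y := by
  rw [trail_apply, trailFun]
  split_ifs with h1
  · exact γ.eq_of_length_eq_zero (le_antisymm (h.trans h1) (γ.length_nonneg x y))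
  · rfl

theorem dist_trail_trail_le (x y : X) (s t : ℝ) :
    dist (γ.trail x y s) (γ.trail x y t) ≤ |s - t| := by
  simpa [Real.dist_eq, ← trail_apply] using (γ.lipschitzWith_trailFun x y).dist_le_mul s t

theorem dist_trail_le_length (x y : X) (t : ℝ) : dist x (γ.trail x y t) ≤ γ.length x y := by
  rw [trail_apply, trailFun_eq]
  exact dist_path_le_length _ _ _

theorem trail_mul_length (hconst : ∀ (x : X) (t : I), γ.path x x t = x) (x y : X) (s : I) :
    γ.trail x y (s * γ.length x y) = γ.path x y s := by
  rcases (γ.length_nonneg x y).eq_or_lt with h0 | h0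
  · obtain rfl := γ.eq_of_length_eq_zero h0.symm
    rw [trail_of_nonpos _ _ (by rw [← h0, mul_zero]), hconst]
  · rw [trail_apply, trailFun_eq, mul_div_assoc, div_self h0.ne', mul_one, projIcc_val]

theorem exists_trail_eq_path (hconst : ∀ (x : X) (t : I), γ.path x x t = x) {x y : X} {u : ℝ}
    (h0 : 0 ≤ u) (h1 : u ≤ γ.length x y) :
    ∃ s : I, u = s * γ.length x y ∧ γ.trail x y u = γ.path x y s := by
  obtain ⟨s, hs⟩ : ∃ s : I, u = s * γ.length x y := by
    rcases (γ.length_nonneg x y).eq_or_lt with h | h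
    · exact ⟨0, by rw [← h] at h1 ⊢; simpa using le_antisymm h1 h0⟩
    · exact ⟨⟨u / γ.length x y, div_nonneg h0 h.le, (div_le_one h).2 h1⟩, by field_simp⟩
  exact ⟨s, hs, by rw [hs, trail_mul_length hconst]⟩

theorem Consistent.length_trail (hc : γ.Consistent)
    (hconst : ∀ (x : X) (t : I), γ.path x x t = x) {x y : X} {u : ℝ} (h0 : 0 ≤ u)
    (h1 : u ≤ γ.length x y) : γ.length x (γ.trail x y u) = u := by
  obtain ⟨s, hs, hp⟩ := exists_trail_eq_path hconst h0 h1
  rw [hp, hc.length_path hconst, ← hs]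

/-- Consistency for trails: the trail to a point of `c_{x,y}` agrees with `c_{x,y}` until it
reaches this point. -/
theorem Consistent.trail_trail (hc : γ.Consistent)
    (hconst : ∀ (x : X) (t : I), γ.path x x t = x) {x y : X} {u v : ℝ} (h0 : 0 ≤ u)
    (h1 : u ≤ γ.length x y) (hv : v ≤ u) :
    γ.trail x (γ.trail x y u) v = γ.trail x y v := by
  rcases le_total v 0 with hv0 | hv0
  · rw [trail_of_nonpos _ _ hv0, trail_of_nonpos _ _ hv0]
  · obtain ⟨r, hr, hp⟩ := exists_trail_eq_path hconst hv0
      (hv.trans_eq (hc.length_trail hconst h0 h1).symm)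
    obtain ⟨s, hs, hq⟩ := exists_trail_eq_path hconst h0 h1
    rw [hp, hq, hc.path_path hconst, ← trail_mul_length hconst]
    congr 1
    rw [hr, hc.length_trail hconst h0 h1, hs, Icc.coe_mul]
    ring

theorem LengthControl.continuous_trail {f : ℝ≥0 → ℝ≥0} (hf : γ.LengthControl f) :
    Continuous fun p : X × X × ℝ => γ.trail p.1 p.2.1 p.2.2 := by
  have hl : Continuous fun p : X × X × ℝ => γ.length p.1 p.2.1 :=
    hf.continuous_length_comp (by fun_prop) (by fun_prop)
  refine continuous_iff_continuousAt.2 fun p => ?_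
  rcases (γ.length_nonneg p.1 p.2.1).eq_or_lt with h0 | h0
  · -- Where the length vanishes, short trails stay close to their starting points.
    have hx : γ.trail p.1 p.2.1 p.2.2 = p.1 := by
      refine (dist_le_zero.1 ?_).symm
      exact (dist_trail_le_length _ _ _).trans h0.symm.le
    refine tendsto_iff_dist_tendsto_zero.2 ?_
    simp only [hx]
    have h1 : Filter.Tendsto (fun q : X × X × ℝ => γ.length q.1 q.2.1 + dist q.1 p.1) (𝓝 p)
        (𝓝 0) := by
      have h2 : Continuous fun q : X × X × ℝ => γ.length q.1 q.2.1 + dist q.1 p.1 :=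
        hl.add (by fun_prop)
      have h3 := h2.tendsto p
      rwa [← h0, dist_self, add_zero] at h3
    refine squeeze_zero (fun _ => dist_nonneg) (fun q => ?_) h1
    refine (dist_triangle _ q.1 _).trans (add_le_add_left ?_ _)
    rw [dist_comm]
    exact dist_trail_le_length _ _ _
  · have h1 : ContinuousAt (fun q : X × X × ℝ =>
        (q.1, q.2.1, projIcc (0 : ℝ) 1 zero_le_one (q.2.2 / γ.length q.1 q.2.1))) p := by
      refine continuousAt_fst.prodMk (ContinuousAt.prodMk (by fun_prop) ?_)
      refine continuous_projIcc.continuousAt.comp ?_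
      exact ContinuousAt.div (by fun_prop) hl.continuousAt h0.ne'
    have h2 := (γ.toMap.continuous.continuousAt (x := _)).comp h1
    refine h2.congr (Filter.Eventually.of_forall fun q => ?_)
    exact (trailFun_eq γ _ _ _).symm

theorem LengthControl.continuous_trail_comp {f : ℝ≥0 → ℝ≥0} (hf : γ.LengthControl f)
    {Z : Type*} [TopologicalSpace Z] {a b : Z → X} {u : Z → ℝ} (ha : Continuous a)
    (hb : Continuous b) (hu : Continuous u) :
    Continuous fun z => γ.trail (a z) (b z) (u z) := by
  have h := hf.continuous_trail.comp (ha.prodMk (hb.prodMk hu))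
  simpa only [Function.comp_def] using h

/-! ### The deformation onto a ball -/

theorem deformation_of_length_le {x₀ x : X} {R : ℝ} (h : γ.length x₀ x ≤ R) (t : I) :
    γ.deformation x₀ R t x = x := by
  refine trail_of_length_le _ _ ?_
  have := mul_nonneg (sub_nonneg.2 t.2.2) (sub_nonneg.2 h)
  linarith

theorem deformation_one (x₀ x : X) (R : ℝ) : γ.deformation x₀ R 1 x = x :=
  trail_of_length_le _ _ (by simp)

/-- The time on the trail `c_{x₀,x}` at which the deformation stops lies between `R` and the
length, for `x` outside the ball. -/
theorem deformation_time_mem {l R : ℝ} (h : R ≤ l) (t : I) :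
    (1 - (t : ℝ)) * (R - l) + l ∈ Icc R l := by
  have h1 := t.2.1
  have h2 := t.2.2
  constructor <;> nlinarith

theorem Consistent.length_deformation (hc : γ.Consistent)
    (hconst : ∀ (x : X) (t : I), γ.path x x t = x) {x₀ x : X} {R : ℝ} (hR : 0 ≤ R)
    (h : R ≤ γ.length x₀ x) (t : I) : γ.length x₀ (γ.deformation x₀ R t x) =
      (1 - (t : ℝ)) * (R - γ.length x₀ x) + γ.length x₀ x :=
  hc.length_trail hconst (hR.trans (deformation_time_mem h t).1) (deformation_time_mem h t).2

theorem Consistent.length_deformation_le (hc : γ.Consistent)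
    (hconst : ∀ (x : X) (t : I), γ.path x x t = x) {x₀ : X} {R : ℝ} (hR : 0 ≤ R) (t : I) (x : X) :
    γ.length x₀ (γ.deformation x₀ R t x) ≤ γ.length x₀ x := by
  rcases le_total (γ.length x₀ x) R with h | h
  · rw [deformation_of_length_le h]
  · rw [hc.length_deformation hconst hR h]
    exact (deformation_time_mem h t).2

theorem Consistent.deformation_zero_mem (hc : γ.Consistent)
    (hconst : ∀ (x : X) (t : I), γ.path x x t = x) {x₀ : X} {R : ℝ} (hR : 0 ≤ R) (x : X) :
    γ.deformation x₀ R 0 x ∈ γ.ball x₀ R := by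
  rcases le_total (γ.length x₀ x) R with h | h
  · rwa [deformation_of_length_le h]
  · change γ.length _ _ ≤ R
    rw [hc.length_deformation hconst hR h]
    simp

/-- The deformation does not change the trail from the centre before time `R`. -/
theorem Consistent.trail_deformation (hc : γ.Consistent)
    (hconst : ∀ (x : X) (t : I), γ.path x x t = x) {x₀ : X} {R : ℝ} (hR : 0 ≤ R) (t : I) (x : X)
    {u : ℝ} (hu : u ≤ R) : γ.trail x₀ (γ.deformation x₀ R t x) u = γ.trail x₀ x u := by
  rcases le_total (γ.length x₀ x) R with h | h
  · rw [deformation_of_length_le h]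
  · have h1 := deformation_time_mem h t
    exact hc.trail_trail hconst (hR.trans h1.1) h1.2 (hu.trans h1.1)

theorem Consistent.deformation_deformation (hc : γ.Consistent)
    (hconst : ∀ (x : X) (t : I), γ.path x x t = x) {x₀ : X} {R : ℝ} (hR : 0 ≤ R) (s t : I) (x : X) :
    γ.deformation x₀ R s (γ.deformation x₀ R t x) = γ.deformation x₀ R (s * t) x := by
  rcases le_total (γ.length x₀ x) R with h | h
  · rw [deformation_of_length_le h, deformation_of_length_le h, deformation_of_length_le h]
  · have h1 := deformation_time_mem h t
    have h2 := hc.length_deformation hconst hR h t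
    rw [deformation, h2]
    have h3 := deformation_time_mem h1.1 s
    refine (hc.trail_trail hconst (hR.trans h1.1) h1.2 h3.2).trans ?_
    rw [deformation]
    congr 1
    rw [Icc.coe_mul]
    ring

theorem LengthControl.continuous_deformation {f : ℝ≥0 → ℝ≥0} (hf : γ.LengthControl f)
    (x₀ : X) (R : ℝ) : Continuous fun p : I × X => γ.deformation x₀ R p.1 p.2 := by
  have hl : Continuous fun p : I × X => γ.length x₀ p.2 :=
    hf.continuous_length_comp (by fun_prop) (by fun_prop)
  unfold deformation
  have h := hf.continuous_trail_comp (Z := I × X) (a := fun _ => x₀) (b := Prod.snd)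
    (u := fun p => (1 - (p.1 : ℝ)) * (R - γ.length x₀ p.2) + γ.length x₀ p.2)
    continuous_const continuous_snd (by fun_prop)
  exact h

end Bicombing

/-! ### The metric of the flow space -/

theorem integrable_one_add_sq_div_exp_abs :
    Integrable fun t : ℝ => (1 + t ^ 2) / (2 * Real.exp |t|) := by
  have hcont : Continuous fun t : ℝ => (1 + t ^ 2) / (2 * Real.exp |t|) :=
    Continuous.div (by fun_prop) (by fun_prop) fun t => by positivity
  refine Integrable.mono' (integrable_inv_one_add_sq.const_mul 15)
    hcont.aestronglyMeasurable (Filter.Eventually.of_forall fun t => ?_)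
  rw [Real.norm_of_nonneg (by positivity), ← div_eq_mul_inv,
    div_le_div_iff₀ (by positivity) (by positivity)]
  have e0 := Real.one_le_exp (abs_nonneg t)
  have e2 := Real.pow_div_factorial_le_exp |t| (abs_nonneg t) 2
  have e4 := Real.pow_div_factorial_le_exp |t| (abs_nonneg t) 4
  norm_num [Nat.factorial] at e2 e4
  rw [(show Even 4 by decide).pow_abs] at e4
  nlinarith

namespace Bicombing.FlowSpace

/-- The integral that bounds distances in the flow space between curves whose pointwise distance
grows at most quadratically in time. -/
noncomputable def weight : ℝ := ∫ t : ℝ, (1 + t ^ 2) / (2 * Real.exp |t|)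

theorem weight_pos : 0 < weight := by
  refine (integral_pos_iff_support_of_nonneg (fun t => by positivity)
    integrable_one_add_sq_div_exp_abs).2 ?_
  have h : Function.support (fun t : ℝ => (1 + t ^ 2) / (2 * Real.exp |t|)) = univ :=
    eq_univ_of_forall fun t => by
      rw [Function.mem_support]
      positivity
  rw [h]
  simp

variable {X : Type u} [MetricSpace X] {γ : Bicombing X}

theorem dist_def (c d : γ.FlowSpace) :
    dist c d = ∫ t : ℝ, dist (c.1 t) (d.1 t) / (2 * Real.exp |t|) := rfl

theorem vadd_apply (t : ℝ) (c : γ.FlowSpace) (s : ℝ) : (t +ᵥ c).1 s = c.1 (s + t) := rfl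

theorem dist_apply_le (c : γ.FlowSpace) (s t : ℝ) : dist (c.1 s) (c.1 t) ≤ |s - t| := by
  simpa [Real.dist_eq] using (γ.lipschitzWith_of_mem_flowSet c.2).dist_le_mul s t

theorem dist_le_mul_weight {c d : γ.FlowSpace} {B : ℝ}
    (h : ∀ t, dist (c.1 t) (d.1 t) ≤ B * (1 + t ^ 2)) : dist c d ≤ B * weight := by
  rw [dist_def, weight, ← integral_const_mul]
  refine integral_mono (integrable_dist c d) (integrable_one_add_sq_div_exp_abs.const_mul B)
    fun t => ?_
  dsimp only
  rw [← mul_div_assoc]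
  gcongr
  exact h t

/-- Two curves that are close on a long time interval around `0` are close in the flow space. -/
theorem dist_le_of_forall_abs_le {c d : γ.FlowSpace} {ε r : ℝ} (hr : 0 < r)
    (h : ∀ t, |t| ≤ r → dist (c.1 t) (d.1 t) ≤ ε) : dist c d ≤ (ε + 1 / r) * weight := by
  have hε : 0 ≤ ε := dist_nonneg.trans (h 0 (by simpa using hr.le))
  refine dist_le_mul_weight fun t => ?_
  rcases le_total |t| r with ht | ht
  · refine (h t ht).trans ?_
    have : 0 ≤ 1 / r := by positivity
    nlinarith [sq_nonneg t, mul_nonneg hε (sq_nonneg t), mul_nonneg this (sq_nonneg t)]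
  · obtain ⟨s, hs, hst⟩ : ∃ s : ℝ, |s| ≤ r ∧ |s - t| = |t| - r := by
      rcases le_total 0 t with h0 | h0
      · rw [abs_of_nonneg h0] at ht ⊢
        exact ⟨r, (abs_of_pos hr).le, by rw [abs_sub_comm, abs_of_nonneg (by linarith)]⟩
      · rw [abs_of_nonpos h0] at ht ⊢
        exact ⟨-r, by rw [abs_neg, abs_of_pos hr], by rw [abs_of_nonneg (by linarith)]; ring⟩
    have h1 := dist_triangle4 (c.1 t) (c.1 s) (d.1 s) (d.1 t)
    have h2 := dist_apply_le c t s
    have h3 := dist_apply_le d s t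
    rw [abs_sub_comm] at h2
    have h4 := h s hs
    -- `|t| - r ≤ t² / (4 r)` because `(|t| - 2 r)² ≥ 0`
    have h5 : 2 * (|t| - r) ≤ 1 / r * t ^ 2 := by
      rw [one_div, ← div_eq_inv_mul, le_div_iff₀ hr]
      nlinarith [sq_nonneg (|t| - r), sq_abs t, sq_nonneg r]
    have : 0 ≤ 1 / r := by positivity
    nlinarith [mul_nonneg hε (sq_nonneg t)]

theorem dist_vadd_vadd_le (s t : ℝ) (c : γ.FlowSpace) :
    dist (s +ᵥ c) (t +ᵥ c) ≤ |s - t| * weight := by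
  refine dist_le_mul_weight fun r => ?_
  rw [vadd_apply, vadd_apply]
  refine (dist_apply_le c _ _).trans ?_
  rw [add_sub_add_left_eq_sub]
  exact le_mul_of_one_le_right (abs_nonneg _) (by nlinarith [sq_nonneg r])

theorem dist_vadd_le (t : ℝ) (c d : γ.FlowSpace) :
    dist (t +ᵥ c) (t +ᵥ d) ≤ Real.exp |t| * dist c d := by
  rw [dist_def c d, ← integral_add_right_eq_self _ t, ← integral_const_mul]
  refine integral_mono (integrable_dist _ _)
    (((integrable_dist c d).comp_add_right t).const_mul _) fun s => ?_
  dsimp only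
  rw [vadd_apply, vadd_apply, ← mul_div_assoc, div_le_div_iff₀ (by positivity) (by positivity)]
  have h : Real.exp |s + t| ≤ Real.exp |t| * Real.exp |s| := by
    rw [← Real.exp_add, add_comm |t|]
    exact Real.exp_le_exp.2 (abs_add_le s t)
  have hd := dist_nonneg (x := c.1 (s + t)) (y := d.1 (s + t))
  nlinarith [mul_le_mul_of_nonneg_left h hd]

theorem continuous_vadd : Continuous fun p : ℝ × γ.FlowSpace => p.1 +ᵥ p.2 := by
  refine continuous_iff_continuousAt.2 fun p => tendsto_iff_dist_tendsto_zero.2 ?_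
  have h : Continuous fun q : ℝ × γ.FlowSpace =>
      Real.exp |q.1| * dist q.2 p.2 + |q.1 - p.1| * weight := by fun_prop
  have h0 := h.tendsto p
  rw [dist_self, mul_zero, sub_self, abs_zero, zero_mul, add_zero] at h0
  refine squeeze_zero (fun _ => dist_nonneg) (fun q => ?_) h0
  exact (dist_triangle _ (q.1 +ᵥ p.2) _).trans
    (add_le_add (dist_vadd_le _ _ _) (dist_vadd_vadd_le _ _ _))

/-- A bound for the distance of curves at time `0` in terms of their distance in the flow space. -/
theorem exists_dist_apply_zero_le :
    ∃ a : ℝ, ∀ c d : γ.FlowSpace, dist (c.1 0) (d.1 0) ≤ a * (dist c d + weight) := by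
  have hint : Integrable fun t : ℝ => 1 / (2 * Real.exp |t|) := by
    have hcont : Continuous fun t : ℝ => 1 / (2 * Real.exp |t|) :=
      Continuous.div (by fun_prop) (by fun_prop) fun t => by positivity
    refine integrable_one_add_sq_div_exp_abs.mono' hcont.aestronglyMeasurable
      (Filter.Eventually.of_forall fun t => ?_)
    rw [Real.norm_of_nonneg (by positivity)]
    gcongr
    nlinarith [sq_nonneg t]
  have hpos : 0 < ∫ t : ℝ, 1 / (2 * Real.exp |t|) := by
    refine (integral_pos_iff_support_of_nonneg (fun t => by positivity) hint).2 ?_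
    have h : Function.support (fun t : ℝ => 1 / (2 * Real.exp |t|)) = univ :=
      eq_univ_of_forall fun t => by
        rw [Function.mem_support]
        positivity
    rw [h]
    simp
  refine ⟨(∫ t : ℝ, 1 / (2 * Real.exp |t|))⁻¹, fun c d => ?_⟩
  rw [← div_eq_inv_mul, le_div_iff₀ hpos, ← integral_const_mul, dist_def, weight,
    ← integral_add (integrable_dist c d) integrable_one_add_sq_div_exp_abs]
  refine integral_mono (hint.const_mul _)
    ((integrable_dist c d).add integrable_one_add_sq_div_exp_abs) fun t => ?_
  dsimp only
  rw [← mul_div_assoc, ← add_div, mul_one]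
  gcongr
  have h1 := dist_triangle4 (c.1 0) (c.1 t) (d.1 t) (d.1 0)
  have h2 := dist_apply_le c 0 t
  have h3 := dist_apply_le d t 0
  rw [zero_sub, abs_neg] at h2
  rw [sub_zero] at h3
  nlinarith [sq_nonneg (|t| - 1), sq_abs t]

theorem continuous_ofTrail {f : ℝ≥0 → ℝ≥0} (hf : γ.LengthControl f) :
    Continuous fun p : X × X => ofTrail γ p.1 p.2 := by
  refine continuous_iff_continuousAt.2 fun p => tendsto_iff_dist_tendsto_zero.2 ?_
  have hsum : Integrable fun t : ℝ => 2 * ((1 + t ^ 2) / (2 * Real.exp |t|)) :=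
    integrable_one_add_sq_div_exp_abs.const_mul 2
  have key : ContinuousAt (fun q : X × X => ∫ t : ℝ,
      dist (γ.trail q.1 q.2 t) (γ.trail p.1 p.2 t) / (2 * Real.exp |t|)) p := by
    refine continuousAt_of_dominated (bound := fun t => 2 * ((1 + t ^ 2) / (2 * Real.exp |t|)))
      (Filter.Eventually.of_forall fun q => ?_) ?_ hsum (Filter.Eventually.of_forall fun t => ?_)
    · exact (Continuous.div ((γ.trail q.1 q.2).continuous.dist (γ.trail p.1 p.2).continuous)
        (by fun_prop) fun t => by positivity).aestronglyMeasurable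
    · have h : ∀ᶠ q : X × X in 𝓝 p, dist q.1 p.1 < 1 :=
        continuous_fst.continuousAt.eventually (Metric.ball_mem_nhds p.1 zero_lt_one)
      filter_upwards [h] with q hq
      refine Filter.Eventually.of_forall fun t => ?_
      rw [Real.norm_of_nonneg (by positivity), ← mul_div_assoc]
      gcongr
      have h1 := dist_triangle4 (γ.trail q.1 q.2 t) (γ.trail q.1 q.2 0) (γ.trail p.1 p.2 0)
        (γ.trail p.1 p.2 t)
      have h2 := dist_trail_trail_le (γ := γ) q.1 q.2 t 0
      have h3 := dist_trail_trail_le (γ := γ) p.1 p.2 0 t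
      rw [trail_of_nonpos _ _ le_rfl, trail_of_nonpos _ _ le_rfl] at h1
      rw [trail_of_nonpos _ _ le_rfl, sub_zero] at h2
      rw [trail_of_nonpos _ _ le_rfl, zero_sub, abs_neg] at h3
      nlinarith [sq_nonneg (|t| - 1), sq_abs t]
    · exact ((Continuous.dist (hf.continuous_trail_comp continuous_fst continuous_snd
        continuous_const) continuous_const).div_const _).continuousAt
  have h0 := key.tendsto
  simp only [dist_self, zero_div, integral_zero] at h0
  exact h0

/-! ### The flow space is a flow space for the group -/

section Action

variable {G : Type*} [Group G] [MulAction G X] [IsIsometricSMul G X] [γ.Equivariant G]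

theorem smul_apply (g : G) (c : γ.FlowSpace) (t : ℝ) : (g • c).1 t = g • c.1 t := rfl

theorem isIsometricSMul : IsIsometricSMul G γ.FlowSpace :=
  ⟨fun g => Isometry.of_dist_eq fun c d => by simp only [dist_def, smul_apply, dist_smul]⟩

theorem smul_ofTrail (g : G) (x y : X) : g • ofTrail γ x y = ofTrail γ (g • x) (g • y) :=
  Subtype.ext (smulMap_trail g x y)

theorem properlyDiscontinuousSMul [ProperSpace X] [ProperlyDiscontinuousSMul G X] :
    ProperlyDiscontinuousSMul G γ.FlowSpace := by
  refine ⟨fun {K L} hK hL => ?_⟩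
  -- Evaluation at time `0` maps bounded sets to bounded sets, so the claim follows from `X`.
  obtain ⟨a, ha⟩ := exists_dist_apply_zero_le (γ := γ)
  have hb : ∀ K : Set γ.FlowSpace, IsCompact K →
      IsCompact (closure ((fun c : γ.FlowSpace => c.1 0) '' K)) := by
    intro K hK
    refine Bornology.IsBounded.isCompact_closure ?_
    obtain ⟨C, hC⟩ := Metric.isBounded_iff.1 hK.isBounded
    refine Metric.isBounded_iff.2 ⟨|a| * (C + weight), ?_⟩
    rintro _ ⟨c, hc, rfl⟩ _ ⟨d, hd, rfl⟩
    refine (ha c d).trans ?_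
    have hw := weight_pos
    have h1 := hC hc hd
    have h2 := dist_nonneg (x := c) (y := d)
    exact mul_le_mul (le_abs_self a) (by linarith) (by linarith) (abs_nonneg a)
  refine (ProperlyDiscontinuousSMul.finite_disjoint_inter_image (Γ := G) (hb K hK)
    (hb L hL)).subset ?_
  rintro g ⟨_, ⟨c, hc, rfl⟩, hd⟩
  exact ⟨g • c.1 0, ⟨c.1 0, subset_closure ⟨c, hc, rfl⟩, rfl⟩,
    subset_closure ⟨g • c, hd, rfl⟩⟩

theorem isFlowSpace [TopologicalSpace G] [DiscreteTopology G] [ProperSpace X]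
    [ProperlyDiscontinuousSMul G X] : IsFlowSpace G γ.FlowSpace where
  smul_vadd _ _ _ := rfl
  continuous_action := by
    have := isIsometricSMul (G := G) (γ := γ)
    have h : Continuous fun p : G × (ℝ × γ.FlowSpace) => p.1 • (p.2.1 +ᵥ p.2.2) :=
      continuous_prod_of_discrete_left.2 fun g => (isometry_smul _ g).continuous.comp continuous_vadd
    exact h.comp (f := fun p : (G × ℝ) × γ.FlowSpace => (p.1.1, p.1.2, p.2)) (by fun_prop)
  isometric := isIsometricSMul
  proper := properlyDiscontinuousSMul

end Action

end Bicombing.FlowSpace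

/-! ### The strong homotopy action on a ball -/

namespace Bicombing

variable {X : Type u} [MetricSpace X] {γ : Bicombing X}

section Omega

variable {G : Type*} [Group G] [MulAction G X]

theorem omega_append (x₀ : X) (R : ℝ) (a b : List (G × I)) (g g₀ : G) (t : I) (x : X) :
    γ.omega x₀ R (a ++ (g, t) :: b) g₀ x =
      γ.omega x₀ R a g (γ.deformation x₀ R t (γ.omega x₀ R b g₀ x)) := by
  induction a with
  | nil => rfl
  | cons p a ih => simp only [List.cons_append, omega, ih]

theorem omega_mul (x₀ : X) (R : ℝ) (a : List (G × I)) (g h : G) (x : X) :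
    γ.omega x₀ R a (g * h) x = γ.omega x₀ R a g (h • x) := by
  induction a with
  | nil => exact mul_smul g h x
  | cons p a ih => simp only [omega, ih]

theorem LengthControl.continuous_omega [TopologicalSpace G] [DiscreteTopology G]
    [IsIsometricSMul G X] {f : ℝ≥0 → ℝ≥0} (hf : γ.LengthControl f) (x₀ : X) (R : ℝ) (j : ℕ) :
    Continuous fun p : (Fin j → G × I) × G × X => γ.omega x₀ R (List.ofFn p.1) p.2.1 p.2.2 := by
  have hs : Continuous fun p : G × X => p.1 • p.2 :=
    continuous_prod_of_discrete_left.2 fun g => (isometry_smul X g).continuous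
  induction j with
  | zero =>
    simp only [List.ofFn_zero, omega]
    exact hs.comp continuous_snd
  | succ j ih =>
    simp only [List.ofFn_succ, omega]
    have h1 := ih.comp (f := fun p : (Fin (j + 1) → G × I) × G × X =>
      (fun i => p.1 (Fin.succ i), p.2)) (by fun_prop)
    have h2 := (hf.continuous_deformation x₀ R).comp
      ((by fun_prop : Continuous fun p : (Fin (j + 1) → G × I) × G × X => (p.1 0).2).prodMk h1)
    exact hs.comp
      ((by fun_prop : Continuous fun p : (Fin (j + 1) → G × I) × G × X => (p.1 0).1).prodMk h2)

/-- The strong homotopy action `H_0 ∘ Ω` of `G` on the ball `P_R(x₀)`. -/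
noncomputable def strongHomotopyAction [TopologicalSpace G] [DiscreteTopology G]
    [IsIsometricSMul G X] (hc : γ.Consistent) (hconst : ∀ (x : X) (t : I), γ.path x x t = x)
    {f : ℝ≥0 → ℝ≥0} (hf : γ.LengthControl f) (x₀ : X) {R : ℝ} (hR : 0 ≤ R) :
    StrongHomotopyAction G (γ.ball x₀ R) where
  toFun a g y := ⟨γ.deformation x₀ R 0 (γ.omega x₀ R a g y), hc.deformation_zero_mem hconst hR _⟩
  continuous_toFun j := by
    refine Continuous.subtype_mk ?_ _
    have h := (hf.continuous_omega (G := G) x₀ R j).comp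
      (f := fun p : (Fin j → G × I) × G × γ.ball x₀ R => (p.1, p.2.1, (p.2.2 : X))) (by fun_prop)
    have h' := (hf.continuous_deformation x₀ R).comp ((continuous_const (y := (0 : I))).prodMk h)
    exact h'
  time_zero a b g g₀ y := by simp only [omega_append]
  time_one a b g h t g₀ y := by
    simp only [omega_append, omega, deformation_one, omega_mul]
  time_one_last a g g₀ y := by
    simp only [omega_append, omega, deformation_one, omega_mul]
  one_first t b g₀ y := by
    simp only [omega, one_smul, hc.deformation_deformation hconst hR, zero_mul]
  one_middle a b g s t g₀ y := by
    simp only [omega_append, omega, one_smul, hc.deformation_deformation hconst hR]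
  one_last a g t y := by
    simp only [omega_append, omega, one_smul, deformation_of_length_le y.2]
  one_nil y := Subtype.ext (by simp only [omega, one_smul, deformation_of_length_le y.2])

end Omega

/-! ### Contraction of trails -/

/-- Trails that end at the same point are close if they are compared at times of equal distance
from their ends, and this distance is small in comparison with the lengths. -/
theorem AConvex.dist_trail_le {A : I × ℝ≥0 × ℝ≥0 → ℝ≥0} (hA : γ.AConvex A)
    (hconst : ∀ (x : X) (t : I), γ.path x x t = x) (x x' y : X) (s : I) :
    dist (γ.trail x y (s * γ.length x y))
      (γ.trail x' y (γ.length x' y - (1 - s) * γ.length x y)) ≤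
      A (s, nndist x x', 0) + (1 - s) * |γ.length x' y - γ.length x y| := by
  have h1 := hA.dist_le x x' y y s
  rw [nndist_self, ← trail_mul_length hconst, ← trail_mul_length hconst] at h1
  refine (dist_triangle _ (γ.trail x' y (s * γ.length x' y)) _).trans (add_le_add h1 ?_)
  refine (dist_trail_trail_le _ _ _ _).trans_eq ?_
  rw [← abs_of_nonneg (sub_nonneg.2 s.2.2), ← abs_mul, abs_of_nonneg (sub_nonneg.2 s.2.2),
    ← abs_neg]
  congr 1
  ring

theorem AConvex.dist_trail_add_le {A : I × ℝ≥0 × ℝ≥0 → ℝ≥0} (hA : γ.AConvex A)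
    (hconst : ∀ (x : X) (t : I), γ.path x x t = x) {x x' y : X} {C ε η L u : ℝ}
    (hε : 0 ≤ ε) (hη : 0 ≤ η) (hs : ∀ s : I, 1 - η ≤ s → (A (s, nndist x x', 0) : ℝ) ≤ ε)
    (hC : |γ.length x' y - γ.length x y| ≤ C) (hL : γ.length x y ≤ L) (hu : 0 < u)
    (hLu : L - u ≤ η * u) :
    dist (γ.trail x y u) (γ.trail x' y (u + (γ.length x' y - γ.length x y))) ≤ ε + η * C := by
  have hC0 : 0 ≤ C := (abs_nonneg _).trans hC
  rcases le_or_gt (γ.length x y) u with h | h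
  · rw [trail_of_length_le _ _ h, trail_of_length_le _ _ (by linarith), dist_self]
    positivity
  · have hl : 0 < γ.length x y := hu.trans h
    obtain ⟨s, hsu⟩ : ∃ s : I, (s : ℝ) = u / γ.length x y :=
      ⟨⟨u / γ.length x y, by positivity, (div_le_one hl).2 h.le⟩, rfl⟩
    have h1 : (s : ℝ) * γ.length x y = u := by rw [hsu]; field_simp
    have h2 : 1 - η ≤ s := by
      rw [hsu, le_div_iff₀ hl]
      nlinarith
    have h3 := hA.dist_trail_le hconst x x' y s
    rw [h1, (by rw [← h1]; ring : γ.length x' y - (1 - s) * γ.length x y =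
      u + (γ.length x' y - γ.length x y))] at h3
    refine h3.trans (add_le_add (hs s h2) ?_)
    exact mul_le_mul (by linarith) hC (abs_nonneg _) hη

section Contraction

variable {G : Type*} [Group G] [MulAction G X] [IsIsometricSMul G X] [γ.Equivariant G]

theorem smul_trail (g : G) (x y : X) (t : ℝ) :
    g • γ.trail x y t = γ.trail (g • x) (g • y) t :=
  DFunLike.congr_fun (FlowSpace.smulMap_trail g x y) t

theorem length_inv_smul (g : G) (x y : X) :
    γ.length (g⁻¹ • x) y = γ.length x (g • y) := by
  rw [← FlowSpace.length_smul g (g⁻¹ • x) y, smul_inv_smul]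

/-- The trail to `y` and the translate of the trail to `Ω(g_j, t_j, …, g_0, y)` by
`(g_j ⋯ g_0)⁻¹` are close, up to a bounded shift of time, at large times below `R`. In each of the
steps, the deformation does not change the trail before time `R`, and only the change of the
starting point by a group element has to be estimated. -/
theorem exists_shift_dist_omega_le (hc : γ.Consistent)
    (hconst : ∀ (x : X) (t : I), γ.path x x t = x) {A : I × ℝ≥0 × ℝ≥0 → ℝ≥0} (hA : γ.AConvex A)
    {S : Set G} {x₀ : X} {R C ε η : ℝ} (hR : 0 ≤ R) (hC0 : 0 ≤ C) (hε0 : 0 ≤ ε) (hη : 0 ≤ η)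
    (hC : ∀ g ∈ S, ∀ z : X, |γ.length (g⁻¹ • x₀) z - γ.length x₀ z| ≤ C)
    (hε : ∀ g ∈ S, ∀ s : I, 1 - η ≤ s → (A (s, nndist x₀ (g⁻¹ • x₀), 0) : ℝ) ≤ ε)
    {y : X} (hy : γ.length x₀ y ≤ R) (a : List (G × I)) (g₀ : G) (ha : ∀ p ∈ a, p.1 ∈ S)
    (hg₀ : g₀ ∈ S) :
    γ.length x₀ (γ.omega x₀ R a g₀ y) ≤ R + (a.length + 1) * C ∧
    ∃ τ : ℝ, |τ| ≤ (a.length + 1) * C ∧ ∀ u : ℝ, u + (a.length + 1) * C ≤ R →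
      0 < u - (a.length + 1) * C → R + (a.length + 1) * C ≤ (1 + η) * (u - (a.length + 1) * C) →
      dist (γ.trail x₀ y u)
        (((a.map Prod.fst).prod * g₀)⁻¹ • γ.trail x₀ (γ.omega x₀ R a g₀ y) (u + τ)) ≤
        (a.length + 1) * (ε + η * C) := by
  induction a with
  | nil =>
    simp only [List.length_nil, Nat.cast_zero, zero_add, one_mul, omega, List.map_nil,
      List.prod_nil]
    have h := hC g₀ hg₀ y
    rw [← length_inv_smul]
    refine ⟨?_, γ.length (g₀⁻¹ • x₀) y - γ.length x₀ y, h, fun u _ h2 h3 => ?_⟩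
    · linarith [(abs_le.1 h).2]
    · rw [smul_trail, inv_smul_smul]
      exact hA.dist_trail_add_le hconst hε0 hη (hε g₀ hg₀) h hy (by linarith) (by nlinarith)
  | cons p a ih =>
    obtain ⟨g, t⟩ := p
    have hg : g ∈ S := ha (g, t) List.mem_cons_self
    obtain ⟨h1, τ, hτ, h2⟩ := ih fun p hp => ha p (List.mem_cons_of_mem _ hp)
    simp only [List.length_cons, Nat.cast_add, Nat.cast_one, omega, List.map_cons,
      List.prod_cons]
    set w := γ.omega x₀ R a g₀ y
    set w' := γ.deformation x₀ R t w with hw'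
    set j : ℝ := (a.length : ℝ) + 1 with hj
    have h3 := hC g hg w'
    have h4 : γ.length x₀ w' ≤ R + j * C := (hc.length_deformation_le hconst hR t w).trans h1
    rw [← length_inv_smul]
    refine ⟨?_, τ + (γ.length (g⁻¹ • x₀) w' - γ.length x₀ w'), ?_, fun u hu1 hu2 hu3 => ?_⟩
    · linarith [(abs_le.1 h3).2]
    · refine (abs_add_le _ _).trans ?_
      linarith
    · have hτ' := abs_le.1 hτ
      have hjC : (j + 1) * C = j * C + C := by ring
      rw [hjC] at hu1 hu2 hu3
      refine (dist_triangle _ _ _).trans ((add_le_add (h2 u (by linarith) (by linarith)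
        (by nlinarith)) (?_ : _ ≤ ε + η * C)).trans_eq (by ring))
      have hinv : (g * (a.map Prod.fst).prod * g₀)⁻¹ = ((a.map Prod.fst).prod * g₀)⁻¹ * g⁻¹ := by
        rw [mul_assoc, mul_inv_rev]
      rw [hinv, mul_smul, dist_smul, smul_trail, inv_smul_smul,
        ← hc.trail_deformation hconst hR t w (u := u + τ) (by linarith), ← hw', ← add_assoc]
      exact hA.dist_trail_add_le hconst hε0 hη (hε g hg) h3 h4 (by linarith) (by nlinarith)

variable [TopologicalSpace G] [DiscreteTopology G]

/-- The map `ι(g, x) = c_{g x₀, g x}` from `G × P_R(x₀)` to the flow space. -/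
noncomputable def transferMap {f : ℝ≥0 → ℝ≥0} (hf : γ.LengthControl f) (x₀ : X) (R : ℝ) :
    C(G × γ.ball x₀ R, γ.FlowSpace) where
  toFun p := FlowSpace.ofTrail γ (p.1 • x₀) (p.1 • (p.2 : X))
  continuous_toFun := by
    refine continuous_prod_of_discrete_left.2 fun g => ?_
    have h := (isometry_smul X g).continuous.comp (continuous_subtype_val (p := (· ∈ γ.ball x₀ R)))
    have h' := (FlowSpace.continuous_ofTrail hf).comp ((continuous_const (y := g • x₀)).prodMk h)
    exact h'

theorem exists_isContractingTransfer (hc : γ.Consistent)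
    (hconst : ∀ (x : X) (t : I), γ.path x x t = x) {A : I × ℝ≥0 × ℝ≥0 → ℝ≥0} (hA : γ.AConvex A)
    {f : ℝ≥0 → ℝ≥0} (hf : γ.LengthControl f) (x₀ : X) {S : Set G} (hS : S.Finite) (k : ℕ) :
    ∃ β : ℝ, 0 < β ∧ ∀ δ : ℝ, 0 < δ → ∃ (T R : ℝ) (hR : 0 < R), 0 < T ∧
      IsContractingTransfer S k β δ T
        (strongHomotopyAction (G := G) hc hconst hf x₀ hR.le) (transferMap hf x₀ R) := by
  obtain ⟨C, hC0, hC⟩ : ∃ C : ℝ, 0 ≤ C ∧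
      ∀ g ∈ S, ∀ z : X, |γ.length (g⁻¹ • x₀) z - γ.length x₀ z| ≤ C := by
    obtain ⟨C, hC⟩ := (hS.image fun g => f (nndist (g⁻¹ • x₀) x₀)).bddAbove
    refine ⟨C, C.2, fun g hg z => ?_⟩
    have h := hf.abs_sub_le (g⁻¹ • x₀) x₀ z z
    rw [nndist_self, add_zero] at h
    exact h.trans (NNReal.coe_le_coe.2 (hC (mem_image_of_mem _ hg)))
  set j : ℝ := (k : ℝ) + 1 with hj
  have hj0 : 0 < j := by positivity
  refine ⟨j * C + 1, by positivity, fun δ hδ => ?_⟩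
  have hW := FlowSpace.weight_pos
  obtain ⟨W, hWdef⟩ : ∃ W, W = FlowSpace.weight := ⟨_, rfl⟩
  rw [← hWdef] at hW
  -- Half of `δ` is for the pointwise distance in the time window of radius `r`, the other half for
  -- the times outside of this window.
  obtain ⟨r, hr, hrW⟩ : ∃ r : ℝ, 0 < r ∧ 1 / r * W = δ / 2 :=
    ⟨2 * W / δ, by positivity, by field_simp⟩
  obtain ⟨ε, hε, hεW⟩ : ∃ ε : ℝ, 0 < ε ∧ j * (ε + ε) * W = δ / 2 :=
    ⟨δ / (4 * j * W), by positivity, by field_simp; norm_num⟩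
  obtain ⟨η, hη, hηC, hηA⟩ : ∃ η : ℝ, 0 < η ∧ η * C ≤ ε ∧
      ∀ g ∈ S, ∀ s : I, 1 - η ≤ s → (A (s, nndist x₀ (g⁻¹ • x₀), 0) : ℝ) ≤ ε := by
    have h : ∀ᶠ s : I in 𝓝 1, ∀ g ∈ S, (A (s, nndist x₀ (g⁻¹ • x₀), 0) : ℝ) < ε := by
      refine (Filter.eventually_all_finite hS).2 fun g _ => ?_
      have hcont : Continuous fun s : I => (A (s, nndist x₀ (g⁻¹ • x₀), 0) : ℝ) :=
        NNReal.continuous_coe.comp (hA.continuous.comp (by fun_prop))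
      refine hcont.continuousAt.eventually_lt continuousAt_const ?_
      rw [hA.one_zero]
      exact hε
    obtain ⟨η₀, hη₀, h0⟩ := Metric.eventually_nhds_iff.1 h
    refine ⟨min (η₀ / 2) (ε / (C + 1)), by positivity, ?_, fun g hg s hs => (h0 ?_ g hg).le⟩
    · calc _ ≤ ε / (C + 1) * C := by gcongr; exact min_le_right _ _
        _ ≤ ε := by
          rw [div_mul_eq_mul_div, div_le_iff₀ (by positivity)]
          nlinarith
    · have h1 := min_le_left (η₀ / 2) (ε / (C + 1))
      rw [Subtype.dist_eq, Real.dist_eq, abs_sub_comm, Icc.coe_one,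
        abs_of_nonneg (sub_nonneg.2 s.2.2)]
      linarith
  have hjC : 0 ≤ j * C := by positivity
  -- All times in the window around `T`, and their shifts, are at most `R`, and their distance from
  -- `R` is small in comparison with `T`.
  obtain ⟨V, hV⟩ : ∃ V, V = (2 * r + 3 * (j * C)) / η := ⟨_, rfl⟩
  have hVη : η * V = 2 * r + 3 * (j * C) := by rw [hV]; field_simp
  have hV0 : 0 ≤ V := by rw [hV]; positivity
  obtain ⟨T, hT⟩ : ∃ T, T = r + j * C + V + 1 := ⟨_, rfl⟩
  have hR : 0 < T + r + j * C := by linarith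
  refine ⟨T, T + r + j * C, hR, by linarith, fun g g' y => ?_, ?_⟩
  · change FlowSpace.ofTrail γ _ _ = g • FlowSpace.ofTrail γ _ _
    rw [FlowSpace.smul_ofTrail, mul_smul, mul_smul]
  rintro g y s - φ ⟨a, g₀, hak, ha, hg₀, rfl, rfl⟩
  obtain ⟨-, τ, hτ, h⟩ := exists_shift_dist_omega_le hc hconst hA hR.le hC0 hε.le hη.le hC hηA
    y.2 a g₀ ha hg₀
  rw [hak, ← hj] at hτ h
  have hτ' := abs_le.1 hτ
  refine ⟨τ, ⟨by linarith, by linarith⟩, ?_⟩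
  have hE : j * (ε + η * C) ≤ j * (ε + ε) := by gcongr
  refine (FlowSpace.dist_le_of_forall_abs_le hr (ε := j * (ε + ε)) fun t ht => ?_).trans ?_
  · have ht' := abs_le.1 ht
    rw [FlowSpace.vadd_apply, FlowSpace.vadd_apply]
    change dist (γ.trail (g • x₀) (g • (y : X)) (t + T)) (γ.trail _ (_ • γ.deformation _ _ 0 _) _) ≤ _
    rw [mul_smul, mul_smul, ← smul_trail, ← smul_trail, dist_smul, ← smul_trail,
      hc.trail_deformation hconst hR.le _ _ (by linarith), ← add_assoc]
    exact (h (t + T) (by linarith) (by linarith) (by nlinarith)).trans hE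
  · rw [← hWdef, add_mul, hεW, hrW]
    linarith

end Contraction

end Bicombing

/-! ### Balls are compact and contractible -/

namespace Bicombing

variable {X : Type u} [MetricSpace X] {γ : Bicombing X}

theorem continuous_path_comp {Z : Type*} [TopologicalSpace Z] {a b : Z → X} {t : Z → I}
    (ha : Continuous a) (hb : Continuous b) (ht : Continuous t) :
    Continuous fun z => γ.path (a z) (b z) (t z) := by
  have h := γ.toMap.continuous.comp (ha.prodMk (hb.prodMk ht))
  exact h

theorem LengthControl.isClosed_ball {f : ℝ≥0 → ℝ≥0} (hf : γ.LengthControl f) (x₀ : X) (R : ℝ) :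
    IsClosed (γ.ball x₀ R) :=
  isClosed_le (hf.continuous_length_comp continuous_const continuous_id) continuous_const

theorem LengthControl.isCompact_ball [ProperSpace X] {f : ℝ≥0 → ℝ≥0} (hf : γ.LengthControl f)
    (x₀ : X) (R : ℝ) : IsCompact (γ.ball x₀ R) := by
  refine (isCompact_closedBall x₀ R).of_isClosed_subset (hf.isClosed_ball x₀ R) fun y hy => ?_
  rw [Metric.mem_closedBall, dist_comm]
  exact (dist_le_length x₀ y).trans hy

theorem Consistent.contractibleSpace_ball (hc : γ.Consistent)
    (hconst : ∀ (x : X) (t : I), γ.path x x t = x) (x₀ : X) {R : ℝ} (hR : 0 ≤ R) :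
    ContractibleSpace (γ.ball x₀ R) := by
  refine (contractible_iff_id_nullhomotopic _).2
    ⟨⟨x₀, (length_self hconst x₀).trans_le hR⟩, ⟨⟨⟨fun p => ⟨γ.path x₀ p.2 (σ p.1), ?_⟩, ?_⟩,
      fun y => Subtype.ext ?_, fun y => Subtype.ext ?_⟩⟩⟩
  · change γ.length _ _ ≤ R
    rw [hc.length_path hconst]
    exact (mul_le_of_le_one_left (γ.length_nonneg _ _) (σ p.1).2.2).trans p.2.2
  · exact (continuous_path_comp continuous_const (continuous_subtype_val.comp continuous_snd)
      (unitInterval.continuous_symm.comp continuous_fst)).subtype_mk _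
  · change γ.path x₀ y (σ 0) = y
    rw [unitInterval.symm_zero, path_one]
  · change γ.path x₀ y (σ 1) = x₀
    rw [unitInterval.symm_one, path_zero]

/-! ### Iterated paths -/

theorem LengthControl.exists_lt {f : ℝ≥0 → ℝ≥0} (hf : γ.LengthControl f) {ε : ℝ} (hε : 0 < ε) :
    ∃ δ > 0, δ ≤ ε ∧ ∀ x y : X, dist x y < δ → (f (nndist x y) : ℝ) < ε := by
  have h : ∀ᶠ a in 𝓝 (0 : ℝ≥0), (f a : ℝ) < ε := by
    refine (NNReal.continuous_coe.comp hf.continuous).continuousAt.eventually_lt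
      continuousAt_const ?_
    simpa [hf.zero] using hε
  obtain ⟨δ, hδ, h⟩ := Metric.eventually_nhds_iff.1 h
  refine ⟨min δ ε, lt_min hδ hε, min_le_right _ _, fun x y hxy => h ?_⟩
  rw [NNReal.dist_eq, NNReal.coe_zero, sub_zero, coe_nndist, abs_of_nonneg dist_nonneg]
  exact hxy.trans_le (min_le_left _ _)

/-- Paths between points close to `y` stay close to `y`. -/
theorem LengthControl.exists_dist_path_lt {f : ℝ≥0 → ℝ≥0} (hf : γ.LengthControl f)
    (hconst : ∀ (x : X) (t : I), γ.path x x t = x) {ε : ℝ} (hε : 0 < ε) :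
    ∃ δ > 0, δ ≤ ε ∧ ∀ (y q x : X) (t : I), dist q y < δ → dist x y < δ →
      dist (γ.path q x t) y < ε := by
  obtain ⟨δ, hδ, hδε, h⟩ := hf.exists_lt (half_pos hε)
  refine ⟨δ / 2, by positivity, by linarith, fun y q x t hq hx => ?_⟩
  have h1 : dist q x < δ := by
    have := dist_triangle_right q x y
    linarith
  have h2 := dist_triangle (γ.path q x t) q y
  have h3 := dist_path_le_length (γ := γ) q x t
  have h4 := hf.length_le hconst q x
  have h5 := h q x h1
  rw [dist_comm] at h3
  linarith

/-- The end point of a walk that starts at `q` and goes, for each `i` in the list, along the path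
towards `x i` until time `t i`. -/
def walk {ι : Type*} (γ : Bicombing X) (x : ι → X) (t : ι → I) : List ι → X → X
  | [], q => q
  | i :: l, q => walk γ x t l (γ.path q (x i) (t i))

theorem walk_append {ι : Type*} (x : ι → X) (t : ι → I) (l l' : List ι) (q : X) :
    γ.walk x t (l ++ l') q = γ.walk x t l' (γ.walk x t l q) := by
  induction l generalizing q with
  | nil => rfl
  | cons i l ih => exact ih _

theorem continuous_walk {ι Z : Type*} [TopologicalSpace Z] (x : ι → X) {t : Z → ι → I}
    (ht : Continuous t) (l : List ι) {q : Z → X} (hq : Continuous q) :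
    Continuous fun z => γ.walk x (t z) l (q z) := by
  induction l generalizing q with
  | nil => exact hq
  | cons i l ih =>
    exact ih (continuous_path_comp hq continuous_const ((continuous_apply i).comp ht))

/-- A walk with a bounded number of nontrivial steps, all of which go towards points close to `y`,
ends close to `y` if it starts close to `y`. -/
theorem LengthControl.exists_dist_walk_lt {f : ℝ≥0 → ℝ≥0} (hf : γ.LengthControl f)
    (hconst : ∀ (x : X) (t : I), γ.path x x t = x) (N : ℕ) {ε : ℝ} (hε : 0 < ε) :
    ∃ δ > 0, δ ≤ ε ∧ ∀ (m : ℕ) (y : X) (x : Fin m → X) (t : Fin m → I) (F : Finset (Fin m))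
      (l : List (Fin m)) (q : X), F.card ≤ N → l.Nodup → (∀ i ∈ l, t i ≠ 0 → i ∈ F) →
      (∀ i ∈ l, t i ≠ 0 → dist (x i) y < δ) → dist q y < δ → dist (γ.walk x t l q) y < ε := by
  induction N with
  | zero =>
    refine ⟨ε, hε, le_rfl, fun m y x t F l q hF hnd hl hx hq => ?_⟩
    obtain rfl := Finset.card_eq_zero.1 (Nat.le_zero.1 hF)
    induction l generalizing q with
    | nil => exact hq
    | cons i l ih =>
      have hi : t i = 0 := by_contra fun h => Finset.notMem_empty i (hl i List.mem_cons_self h)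
      rw [walk, hi, path_zero]
      exact ih q hnd.of_cons (fun j hj => hx j (List.mem_cons_of_mem _ hj)) hq
        (fun j hj => hl j (List.mem_cons_of_mem _ hj))
  | succ N ih =>
    obtain ⟨δ', hδ', hδε', h'⟩ := ih
    obtain ⟨δ, hδ, hδδ', h⟩ := hf.exists_dist_path_lt hconst hδ'
    refine ⟨δ, hδ, hδδ'.trans hδε', fun m y x t F l q hF hnd hl hx hq => ?_⟩
    induction l generalizing q with
    | nil => exact hq.trans_le (hδδ'.trans hδε')
    | cons i l ihl =>
      obtain ⟨hil, hnd'⟩ := List.nodup_cons.1 hnd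
      rw [walk]
      by_cases hi : t i = 0
      · rw [hi, path_zero]
        exact ihl q hnd' (fun j hj => hl j (List.mem_cons_of_mem _ hj))
          (fun j hj => hx j (List.mem_cons_of_mem _ hj)) hq
      · have hiF := hl i List.mem_cons_self hi
        refine h' m y x t (F.erase i) l _ ?_ hnd' (fun j hj hj0 => ?_)
          (fun j hj hj0 => (hx j (List.mem_cons_of_mem _ hj) hj0).trans_le hδδ')
          (h y q (x i) (t i) hq (hx i List.mem_cons_self hi))
        · rw [Finset.card_erase_of_mem hiF]
          omega
        · exact Finset.mem_erase.2
            ⟨fun hji => hil (hji ▸ hj), hl j (List.mem_cons_of_mem _ hj) hj0⟩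

/-- A walk with a bounded number of nontrivial steps, one of which is complete and all of which go
towards points close to `y`, ends close to `y`, wherever it starts. -/
theorem LengthControl.exists_dist_walk_lt_of_eq_one {f : ℝ≥0 → ℝ≥0} (hf : γ.LengthControl f)
    (hconst : ∀ (x : X) (t : I), γ.path x x t = x) (N : ℕ) {ε : ℝ} (hε : 0 < ε) :
    ∃ δ > 0, ∀ (m : ℕ) (y : X) (x : Fin m → X) (t : Fin m → I) (F : Finset (Fin m))
      (l : List (Fin m)) (q : X), F.card ≤ N → l.Nodup → (∀ i ∈ l, t i ≠ 0 → i ∈ F) →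
      (∀ i ∈ l, t i ≠ 0 → dist (x i) y < δ) → (∃ j ∈ l, t j = 1) →
      dist (γ.walk x t l q) y < ε := by
  obtain ⟨δ, hδ, -, h⟩ := hf.exists_dist_walk_lt hconst N hε
  refine ⟨δ, hδ, fun m y x t F l q hF hnd hl hx ⟨j, hj, hj1⟩ => ?_⟩
  obtain ⟨l₁, l₂, rfl⟩ := List.append_of_mem hj
  have hmem : ∀ i ∈ l₂, i ∈ l₁ ++ j :: l₂ := fun i hi => by simp [hi]
  rw [walk_append, walk, hj1, path_one]
  refine h m y x t F l₂ (x j) hF (List.nodup_cons.1 (List.nodup_append.1 hnd).2.1).2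
    (fun i hi => hl i (hmem i hi)) (fun i hi => hx i (hmem i hi)) (hx j hj ?_)
  rw [hj1]
  exact one_ne_zero

/-! ### Controlled domination of balls -/

theorem LengthControl.dist_deformation_zero_le {f : ℝ≥0 → ℝ≥0} (hf : γ.LengthControl f)
    {x₀ y : X} {R : ℝ} (hy : y ∈ γ.ball x₀ R) (q : X) :
    dist (γ.deformation x₀ R 0 q) q ≤ f (nndist q y) := by
  rcases le_total (γ.length x₀ q) R with h | h
  · rw [deformation_of_length_le h, dist_self]
    positivity
  · have h1 := dist_trail_trail_le (γ := γ) x₀ q R (γ.length x₀ q)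
    rw [trail_of_length_le x₀ q le_rfl] at h1
    have h2 := hf.abs_sub_le x₀ x₀ q y
    rw [nndist_self, zero_add] at h2
    have h3 : γ.length x₀ y ≤ R := hy
    rw [deformation, Icc.coe_zero, sub_zero, one_mul, sub_add_cancel]
    rw [abs_sub_comm, abs_of_nonneg (by linarith)] at h1
    linarith [(abs_le.1 h2).2]

/-- A compact subset `P` of a space of covering dimension at most `n` has finitely many functions
with small supports such that at every point of `P` at most `n + 1` of them do not vanish and at
least one of them has the value `1`. -/
theorem _root_.CoveringDimLE.exists_bumpCovering {n : ℕ} (hdim : CoveringDimLE X n) {P : Set X}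
    (hP : IsCompact P) {δ : ℝ} (hδ : 0 < δ) :
    ∃ (m : ℕ) (b : BumpCovering (Fin m) X P) (x : Fin m → X),
      (∀ i y, b i y ≠ 0 → dist (x i) y < δ) ∧ ∀ y, {i | b i y ≠ 0}.ncard ≤ n + 1 := by
  obtain ⟨V, hVo, hVu, hVr, hVn⟩ := hdim (range fun x : X => Metric.ball x δ)
    (by rintro _ ⟨x, rfl⟩; exact Metric.isOpen_ball)
    (sUnion_eq_univ_iff.2 fun x => ⟨_, ⟨x, rfl⟩, Metric.mem_ball_self hδ⟩)
  obtain ⟨T, hTV, hTf, hTP⟩ := hP.elim_finite_subcover_image (b := V) (c := id) hVo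
    (fun y _ => by simp [← mem_sUnion, hVu])
  have := hTf.to_subtype
  let e := (Finite.equivFin T).symm
  let U : Fin (Nat.card T) → Set X := fun i => e i
  have hUV : ∀ i, U i ∈ V := fun i => hTV (e i).2
  have hinj : Function.Injective U := Subtype.val_injective.comp e.injective
  obtain ⟨b, hb⟩ := BumpCovering.exists_isSubordinate_of_locallyFinite hP.isClosed U
    (fun i => hVo _ (hUV i)) (locallyFinite_of_finite U) (fun y hy => by
      obtain ⟨s, hs, hys⟩ := mem_iUnion₂.1 (hTP hy)
      exact mem_iUnion.2 ⟨e.symm ⟨s, hs⟩, by simpa only [U, e.apply_symm_apply, id] using hys⟩)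
  have hbU : ∀ i y, b i y ≠ 0 → y ∈ U i := fun i y h => hb i (subset_tsupport _ h)
  choose x hx using fun i => hVr _ (hUV i)
  choose z hz using fun i => (hx i).1
  refine ⟨_, b, z, fun i y h => ?_, fun y => ?_⟩
  · have h1 := (hx i).2 (hbU i y h)
    rw [← hz i, Metric.mem_ball, dist_comm] at h1
    exact h1
  · have h1 : (U '' {i | b i y ≠ 0}).encard ≤ n + 1 := by
      refine (encard_le_encard ?_).trans (hVn y)
      rintro _ ⟨i, hi, rfl⟩
      exact ⟨hUV i, hbU i y hi⟩
    rw [hinj.encard_image, ← (toFinite _).cast_ncard_eq] at h1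
    exact_mod_cast h1

/-- The map to the cube given by the functions of a fine bump covering lies in the `n`-skeleton.
Walks with the coordinates as times define a map back, and paths define the homotopy. -/
theorem controlledDominated_ball [ProperSpace X] {n N : ℕ} (hdim : CoveringDimLE X n)
    (hnN : n ≤ N) (hc : γ.Consistent) (hconst : ∀ (x : X) (t : I), γ.path x x t = x)
    {f : ℝ≥0 → ℝ≥0} (hf : γ.LengthControl f) (x₀ : X) {R : ℝ} (hR : 0 ≤ R) :
    ControlledDominated N (γ.ball x₀ R) := by
  intro ε hε
  obtain ⟨ε₁, hε₁, hε₁', h₁⟩ := hf.exists_lt (by positivity : 0 < ε / 4)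
  obtain ⟨ε₂, hε₂, -, h₂⟩ := hf.exists_dist_path_lt hconst hε₁
  obtain ⟨δ, hδ, h₃⟩ := hf.exists_dist_walk_lt_of_eq_one hconst (n + 1) hε₂
  obtain ⟨m, b, x, hbx, hbn⟩ := hdim.exists_bumpCovering (hf.isCompact_ball x₀ R) hδ
  -- the map to the skeleton
  have hb0 : ∀ i y, 0 ≤ b i y := fun i y => b.nonneg i y
  have hb1 : ∀ i y, b i y ≤ 1 := fun i y => b.le_one i y
  have hb : ∀ y ∈ γ.ball x₀ R, ∃ j, b j y = 1 := fun y hy =>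
    (b.eventuallyEq_one' y hy).imp fun j hj => hj.self_of_nhds
  have hskel : ∀ y ∈ γ.ball x₀ R, (∀ i, |2 * b i y - 1| ≤ 1) ∧
      {i | |2 * b i y - 1| < 1}.ncard ≤ n := by
    refine fun y hy => ⟨fun i => ?_, ?_⟩
    · have := hb0 i y
      have := hb1 i y
      exact abs_le.2 ⟨by linarith, by linarith⟩
    · -- a coordinate with `b j y = 1` is not among the free ones
      obtain ⟨j, hj⟩ := hb y hy
      refine Nat.lt_succ_iff.1 ((ncard_lt_ncard ⟨fun i hi => ?_, fun h => ?_⟩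
        (toFinite _)).trans_le (hbn y))
      · intro h0
        simp only [mem_ofPred_eq, h0] at hi
        norm_num at hi
      · have h1 : j ∈ {i | b i y ≠ 0} := by simp [hj]
        have h2 := h h1
        simp only [mem_ofPred_eq, hj] at h2
        norm_num at h2
  let ι : C(γ.ball x₀ R, CubeSkeleton m n) :=
    ⟨fun y => ⟨fun i => 2 * b i y - 1, hskel y y.2⟩, Continuous.subtype_mk (by fun_prop) _⟩
  -- the map back
  let t : CubeSkeleton m n → Fin m → I := fun z i =>
    projIcc 0 1 zero_le_one ((z.1 i + 1) / 2)
  have ht : Continuous t := continuous_pi fun i => continuous_projIcc.comp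
    ((((continuous_apply i).comp continuous_subtype_val).add continuous_const).div_const 2)
  let w : CubeSkeleton m n → X := fun z => γ.walk x (t z) (List.finRange m) x₀
  have hw : Continuous w := continuous_walk x ht _ continuous_const
  have htι : ∀ y i, (t (ι y) i : ℝ) = b i y := fun y i => by
    have h1 : ((2 * b i y - 1) + 1) / 2 = b i y := by ring
    change ((projIcc 0 1 zero_le_one (((2 * b i y - 1) + 1) / 2) : I) : ℝ) = b i y
    rw [h1, projIcc_of_mem zero_le_one ⟨hb0 i y, hb1 i y⟩]
  have hwι : ∀ y, dist (w (ι y)) y < ε₂ := fun y => by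
    have hne : ∀ i, t (ι y) i ≠ 0 → b i y ≠ 0 := fun i hi h0 =>
      hi (Subtype.ext ((htι y i).trans h0))
    obtain ⟨j, hj⟩ := hb y y.2
    refine h₃ m y x (t (ι y)) (toFinite {i | b i y ≠ 0}).toFinset _ _ ?_ (List.nodup_finRange m)
      (fun i _ hi => (Finite.mem_toFinset _).2 (hne i hi)) (fun i _ hi => hbx i y (hne i hi))
      ⟨j, List.mem_finRange j, Subtype.ext ((htι y j).trans hj)⟩
    rw [← ncard_eq_toFinset_card]
    exact hbn y
  let ρ : X → γ.ball x₀ R := fun q =>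
    ⟨γ.deformation x₀ R 0 q, hc.deformation_zero_mem hconst hR q⟩
  have hρ : Continuous ρ := by
    have h := (hf.continuous_deformation x₀ R).comp
      ((continuous_const (y := (0 : I))).prodMk continuous_id)
    exact Continuous.subtype_mk h _
  have hρy : ∀ y : γ.ball x₀ R, ρ y = y := fun y => Subtype.ext (deformation_of_length_le y.2 0)
  have hρd : ∀ (y : γ.ball x₀ R) (q : X), dist q y < ε₁ → dist (ρ q) y ≤ ε / 2 := fun y q hq => by
    have h1 := dist_triangle (γ.deformation x₀ R 0 q) q y
    have h2 := hf.dist_deformation_zero_le y.2 q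
    have h3 := h₁ q y hq
    change dist (γ.deformation x₀ R 0 q) y ≤ ε / 2
    linarith
  refine ⟨CubeSkeleton m n, inferInstance, inferInstance, inferInstance,
    CubeSkeleton.finite_univ, fun d hd => CubeSkeleton.isEmpty_cell (hnN.trans_lt hd),
    ι, ⟨fun z => ρ (w z), hρ.comp hw⟩,
    ⟨⟨fun p => ρ (γ.path (w (ι p.2)) p.2 p.1), ?_⟩, fun y => ?_, fun y => ?_⟩, fun y => ?_⟩
  · have h1 : Continuous fun p : I × γ.ball x₀ R => w (ι p.2) :=
      hw.comp (ι.continuous.comp continuous_snd)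
    have h2 := continuous_path_comp (γ := γ) h1 (continuous_subtype_val.comp continuous_snd)
      continuous_fst
    exact hρ.comp h2
  · change ρ (γ.path (w (ι y)) y 0) = ρ (w (ι y))
    rw [path_zero]
  · change ρ (γ.path (w (ι y)) y 1) = y
    rw [path_one, hρy]
  · refine Metric.diam_le_of_forall_dist_le hε.le ?_
    have h : ∀ s : I, dist (ρ (γ.path (w (ι y)) y s)) y ≤ ε / 2 := fun s =>
      hρd y _ (h₂ y _ y s (hwι y) (by simpa using hε₂))
    rintro _ ⟨s, rfl⟩ _ ⟨s', rfl⟩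
    refine (dist_triangle_right _ _ y).trans ?_
    exact (add_le_add (h s) (h s')).trans_eq (add_halves ε)

end Bicombing

theorem mainTheorem3 {G : Type*} [Group G] [TopologicalSpace G] [DiscreteTopology G]
    {X : Type u} [MetricSpace X] [ProperSpace X] [Nonempty X]
    [MulAction G X] [IsIsometricSMul G X] [ProperlyDiscontinuousSMul G X]
    (hcocompact : ∃ K : Set X, IsCompact K ∧ ∀ x : X, ∃ g : G, ∃ y ∈ K, g • y = x)
    (n : ℕ) (hdim : CoveringDimLE X n)
    (γ : Bicombing X) [γ.Equivariant G] (hconsistent : γ.Consistent)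
    (A : I × ℝ≥0 × ℝ≥0 → ℝ≥0) (hA : γ.AConvex A)
    (hconst : ∀ (x : X) (t : I), γ.path x x t = x)
    (f : ℝ≥0 → ℝ≥0) (hf : γ.LengthControl f) :
    IsFlowSpace G γ.FlowSpace ∧
    AdmitsStrongContractingTransfers G γ.FlowSpace ∧
    ∀ x₀ : X,
      (∀ R : ℝ, 0 < R →
        CompactSpace (γ.ball x₀ R) ∧ ContractibleSpace (γ.ball x₀ R) ∧
        ControlledDominated (2 * n + 1) (γ.ball x₀ R) ∧
        ∃ Ψ : StrongHomotopyAction G (γ.ball x₀ R), ∀ (a : List (G × I)) (g : G) (y : γ.ball x₀ R),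
          (Ψ.toFun a g y : X) = γ.deformation x₀ R 0 (γ.omega x₀ R a g y)) ∧
      ∀ S : Set G, S.Finite → ∀ k : ℕ, ∃ β : ℝ, 0 < β ∧ ∀ δ : ℝ, 0 < δ →
        ∃ (T R : ℝ) (Ψ : StrongHomotopyAction G (γ.ball x₀ R))
          (ι : C(G × γ.ball x₀ R, γ.FlowSpace)),
          0 < T ∧ 0 < R ∧
          (∀ (a : List (G × I)) (g : G) (y : γ.ball x₀ R),
            (Ψ.toFun a g y : X) = γ.deformation x₀ R 0 (γ.omega x₀ R a g y)) ∧
          (∀ (g : G) (y : γ.ball x₀ R),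
            ι (g, y) = Bicombing.FlowSpace.ofTrail γ (g • x₀) (g • (y : X))) ∧
          IsContractingTransfer S k β δ T Ψ ι := by
  have hball : ∀ (x₀ : X) (R : ℝ), 0 < R → CompactSpace (γ.ball x₀ R) ∧
      ContractibleSpace (γ.ball x₀ R) ∧ ControlledDominated (2 * n + 1) (γ.ball x₀ R) :=
    fun x₀ R hR => ⟨isCompact_iff_compactSpace.1 (hf.isCompact_ball x₀ R),
      hconsistent.contractibleSpace_ball hconst x₀ hR.le,
      Bicombing.controlledDominated_ball hdim (by omega) hconsistent hconst hf x₀ hR.le⟩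
  refine ⟨Bicombing.FlowSpace.isFlowSpace, ⟨2 * n + 1, fun S hS k => ?_⟩, fun x₀ =>
    ⟨fun R hR => ?_, fun S hS k => ?_⟩⟩
  · obtain ⟨x₀⟩ := ‹Nonempty X›
    obtain ⟨β, hβ, h⟩ := Bicombing.exists_isContractingTransfer (G := G) hconsistent hconst hA hf
      x₀ hS k
    refine ⟨β, hβ, fun δ hδ => ?_⟩
    obtain ⟨T, R, hR, hT, hι⟩ := h δ hδ
    obtain ⟨h1, h2, h3⟩ := hball x₀ R hR
    exact ⟨T, γ.ball x₀ R, inferInstance, _, _, hT, h2, h1, h3, hι⟩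
  · obtain ⟨h1, h2, h3⟩ := hball x₀ R hR
    exact ⟨h1, h2, h3, Bicombing.strongHomotopyAction hconsistent hconst hf x₀ hR.le,
      fun _ _ _ => rfl⟩
  · obtain ⟨β, hβ, h⟩ := Bicombing.exists_isContractingTransfer (G := G) hconsistent hconst hA hf
      x₀ hS k
    refine ⟨β, hβ, fun δ hδ => ?_⟩
    obtain ⟨T, R, hR, hT, hι⟩ := h δ hδ
    exact ⟨T, R, _, _, hT, hR, fun _ _ _ => rfl, fun _ _ => rfl, hι⟩
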